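/- For $0\le e<1$ let $u(t,e)$ be the solution of Kepler's equation $u-e\sin u=t$, let $r(t,e)=\tfrac12\,(1-e\cos u(t,e))$ and $$F(x,t,e)=\frac{x}{\bigl(x^2+r(t,e)^2\bigr)^{3/2}},$$ and consider the elliptic Sitnikov problem $(S_e)$: $\ddot x+F(x,t,e)=0$. Let $m,p\ge 1$ be integers. A family of odd $(m,p)$-periodic solutions is a family $\phi(t,e)$, $0\le e<e_0$ (for some $0<e_0\le 1$), of solutions of $(S_e)$ on $\mathbb R$ such that $\phi(0,e)=0$ and $\phi(m\pi,e)=0$ for all $e$, the velocity $\dot\phi(0,e)$ is continuous in $e$, $\dot\phi(0,0)>0$, and $\phi(\cdot,0)$ has minimal period $2m\pi/p$. A family of even $(m,p)$-periodic solutions is a family $\varphi(t,e)$, $0\le e<e_0$ (for some $0<e_0\le 1$), of solutions of $(S_e)$ on $\mathbb R$ such that $\dot\varphi(0,e)=0$ and $\dot\varphi(m\pi,e)=0$ for all $e$, the position $\varphi(0,e)$ is continuous in $e$, $\varphi(0,0)>0$, and $\varphi(\cdot,0)$ has minimal period $2m\pi/p$. For such a family $x(t,e)$ the trace is $\psi_1(2m\pi,e)+\dot\psi_2(2m\pi,e)$,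 where $\psi_1(\cdot,e),\psi_2(\cdot,e)$ are the solutions of the linearization $$\ddot y+\frac{\partial F}{\partial x}(x(t,e),t,e)\,y=0$$ with $(\psi_1,\dot\psi_1)(0,e)=(1,0)$ and $(\psi_2,\dot\psi_2)(0,e)=(0,1)$. It is denoted by $\tau_{\mathrm{odd},m,p}(e)$ for an odd family and by $\tau_{\mathrm{even},m,p}(e)$ for an even family. **Lemma.** Let $p,n\ge 1$ be integers. Families of odd and of even $(2pn,p)$-periodic solutions exist, the (right) derivatives $\tau'_{\mathrm{odd},2pn,p}(0)$ and $\tau'_{\mathrm{even},2pn,p}(0)$ at $e=0$ exist and do not depend on the choice of the families, and $$\tau'_{\mathrm{even},2pn,p}(0)=(-1)^n\,\tau'_{\mathrm{odd},2pn,p}(0).$$ -/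

import Mathlib

open Set Real

noncomputable section

namespace Sitnikov

/-- The eccentric anomaly `u(t,e)`: the solution `u` of Kepler's equation `u - e sin u = t`
(for `0 ≤ e < 1` it exists and is unique, see the two facts below). -/
def eccentricAnomaly (t e : ℝ) : ℝ :=
  Function.invFun (fun u : ℝ => u - e * Real.sin u) t

theorem eccentricAnomaly_spec (t e : ℝ) :
    eccentricAnomaly t e - e * Real.sin (eccentricAnomaly t e) = t := by
  have hc : Continuous (fun u : ℝ => u - e * Real.sin u) := by fun_prop
  have hb : ∀ u : ℝ, |e * Real.sin u| ≤ |e| := fun u => by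
    rw [abs_mul]
    exact mul_le_of_le_one_right (abs_nonneg e) (Real.abs_sin_le_one u)
  have h : ∃ u : ℝ, (fun u : ℝ => u - e * Real.sin u) u = t := by
    have h1 := abs_le.1 (hb (t - |e|))
    have h2 := abs_le.1 (hb (t + |e|))
    have hle : t - |e| ≤ t + |e| := by linarith [abs_nonneg e]
    obtain ⟨u, -, hu⟩ := intermediate_value_Icc hle hc.continuousOn
      (show t ∈ Icc _ _ from ⟨by linarith [h1.1, h1.2], by linarith [h2.1, h2.2]⟩)
    exact ⟨u, hu⟩
  exact Function.invFun_eq h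

theorem eccentricAnomaly_unique {t e u : ℝ} (he : |e| < 1) (hu : u - e * Real.sin u = t) :
    u = eccentricAnomaly t e := by
  have hv := eccentricAnomaly_spec t e
  set v := eccentricAnomaly t e
  by_contra hne
  have h1 : u - v = e * (Real.sin u - Real.sin v) := by linarith
  have h2 : |Real.sin u - Real.sin v| ≤ |u - v| := by
    simpa [Real.dist_eq] using Real.abs_sin_sub_sin_le u v
  have h3 : 0 < |u - v| := abs_pos.2 (sub_ne_zero.2 hne)
  have h4 : |u - v| = |e| * |Real.sin u - Real.sin v| := by
    conv_lhs => rw [h1]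
    exact abs_mul _ _
  nlinarith [abs_nonneg e]

/-- The distance `r(t,e) = (1/2) (1 - e cos u(t,e))` of the primaries to the origin. -/
def radius (t e : ℝ) : ℝ :=
  (1 / 2) * (1 - e * Real.cos (eccentricAnomaly t e))

/-- The force term `F(x,t,e) = x / (x² + r(t,e)²)^{3/2}` of the elliptic Sitnikov problem. -/
def force (x t e : ℝ) : ℝ :=
  x / (x ^ 2 + radius t e ^ 2) ^ ((3 : ℝ) / 2)

/-- `x` is a (classical, global) solution of the scalar second order equation
`x'' + G(x, t) = 0`. -/
def IsSolution (G : ℝ → ℝ → ℝ) (x : ℝ → ℝ) : Prop :=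
  Differentiable ℝ x ∧ ∀ t : ℝ, HasDerivAt (deriv x) (-G (x t) t) t

/-- The solution of Hill's equation `y'' + q(t) y = 0` with `y(0) = a`, `y'(0) = b`.
(It exists and is unique for continuous `q`.) -/
def hillSolution (q : ℝ → ℝ) (a b : ℝ) : ℝ → ℝ :=
  Classical.epsilon fun y : ℝ → ℝ =>
    IsSolution (fun x t => q t * x) y ∧ y 0 = a ∧ deriv y 0 = b

/-- The trace `ψ₁(T) + ψ₂'(T)` of the `T`-Poincaré matrix of `y'' + q(t) y = 0`, where
`ψ₁`, `ψ₂` are the fundamental solutions. -/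
def hillTrace (q : ℝ → ℝ) (T : ℝ) : ℝ :=
  hillSolution q 1 0 T + deriv (hillSolution q 0 1) T

/-- For a family `x(t,e)` of functions: the trace `τ(e)` of the `2mπ`-Poincaré matrix of the
linearization `y'' + ∂F/∂x(x(t,e),t,e) y = 0` along `x(·,e)`. -/
def linearizedTrace (m : ℕ) (x : ℝ → ℝ → ℝ) (e : ℝ) : ℝ :=
  hillTrace (fun t => deriv (fun z => force z t e) (x t e)) (2 * m * π)

/-- `T` is the minimal period of `x`. -/
def IsMinimalPeriod (x : ℝ → ℝ) (T : ℝ) : Prop :=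
  IsLeast {S : ℝ | 0 < S ∧ Function.Periodic x S} T

/-- `φ(t,e)`, `0 ≤ e < e₀`, is a family of odd `(m,p)`-periodic solutions of the elliptic
Sitnikov problem: `φ(·,e)` is the solution starting at `φ(0,e) = 0` with a velocity that depends
continuously on `e`, subject to the bifurcation equation `φ(mπ,e) = 0` (so that `φ(·,e)` is odd
and `2mπ`-periodic), and `φ(·,0)` is the odd solution of the circular problem with positive
initial velocity and minimal period `2mπ/p`. -/
structure IsOddFamily (m p : ℕ) (e₀ : ℝ) (φ : ℝ → ℝ → ℝ) : Prop where
  pos : 0 < e₀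
  le_one : e₀ ≤ 1
  solution : ∀ e ∈ Ico 0 e₀, IsSolution (fun x t => force x t e) (fun t => φ t e)
  initial : ∀ e ∈ Ico 0 e₀, φ 0 e = 0
  half_period : ∀ e ∈ Ico 0 e₀, φ (m * π) e = 0
  continuousOn_velocity : ContinuousOn (fun e => deriv (fun t => φ t e) 0) (Ico 0 e₀)
  velocity_pos : 0 < deriv (fun t => φ t 0) 0
  minimal_period : IsMinimalPeriod (fun t => φ t 0) (2 * m * π / p)

/-- `φ(t,e)`, `0 ≤ e < e₀`, is a family of even `(m,p)`-periodic solutions of the elliptic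
Sitnikov problem: `φ(·,e)` is the solution starting with `φ'(0,e) = 0` at a position that depends
continuously on `e`, subject to the bifurcation equation `φ'(mπ,e) = 0` (so that `φ(·,e)` is even
and `2mπ`-periodic), and `φ(·,0)` is the even solution of the circular problem with positive
initial position and minimal period `2mπ/p`. -/
structure IsEvenFamily (m p : ℕ) (e₀ : ℝ) (φ : ℝ → ℝ → ℝ) : Prop where
  pos : 0 < e₀
  le_one : e₀ ≤ 1
  solution : ∀ e ∈ Ico 0 e₀, IsSolution (fun x t => force x t e) (fun t => φ t e)
  initial : ∀ e ∈ Ico 0 e₀, deriv (fun t => φ t e) 0 = 0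
  half_period : ∀ e ∈ Ico 0 e₀, deriv (fun t => φ t e) (m * π) = 0
  continuousOn_position : ContinuousOn (fun e => φ 0 e) (Ico 0 e₀)
  position_pos : 0 < φ 0 0
  minimal_period : IsMinimalPeriod (fun t => φ t 0) (2 * m * π / p)

end Sitnikov

end

/-!
At `e = 0` the problem is autonomous, and its even periodic solutions are the translates of the odd
ones by a quarter of their period. The period depends on the amplitude, so the monodromy of the
linearization along a circular periodic solution `x`, with periodic solution `χ = x'`, is parabolic
and not the identity. Hence the implicit function theorem continues `x` to `e > 0`, and the
derivative of the trace at `e = 0` is a multiple of `∫ q₁ χ²`, where `q₁` is the derivative of the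
potential along the family. The first variation of the family enters `q₁`, but an integration by
parts removes it and leaves a multiple of `∫ g(x(t)) x'(t) sin t dt` for an explicit function `g`.
For period `4pnπ` with `p` oscillations, the quarter period is `nπ`, and translation of `x` by `nπ`
multiplies this integral by `(-1)ⁿ`, because `sin (t + nπ) = (-1)ⁿ sin t`.
-/

noncomputable section

namespace Sitnikov

open Filter Function MeasureTheory
open scoped NNReal Topology BoundedContinuousFunction

section GlobalExistence

variable {E : Type*} [NormedAddCommGroup E] [NormedSpace ℝ E]

/-- The weight `exp |∫₀ᵗ κ|`, for which Picard's operator is a contraction on the whole line. -/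
def bieleckiWeight (κ : ℝ → ℝ) (t : ℝ) : ℝ :=
  exp |(∫ s in 0..t, κ s)|

theorem one_le_bieleckiWeight (κ : ℝ → ℝ) (t : ℝ) : 1 ≤ bieleckiWeight κ t :=
  one_le_exp (abs_nonneg _)

theorem continuous_bieleckiWeight {κ : ℝ → ℝ} (hκ : Continuous κ) :
    Continuous (bieleckiWeight κ) :=
  (intervalIntegral.continuous_primitive (fun a b => hκ.intervalIntegrable a b) 0).abs.rexp

theorem abs_integral_mul_bieleckiWeight_le {κ : ℝ → ℝ} (hκ : Continuous κ) (hκ₀ : ∀ t, 0 ≤ κ t)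
    (t : ℝ) : |(∫ s in 0..t, κ s * bieleckiWeight κ s)| ≤ bieleckiWeight κ t := by
  set A : ℝ → ℝ := fun t => ∫ r in 0..t, κ r
  have hA (s : ℝ) : HasDerivAt A (κ s) s := (hκ.integral_hasStrictDerivAt 0 s).hasDerivAt
  have hA₀ : A 0 = 0 := intervalIntegral.integral_same
  have hA_mono : Monotone A := monotone_of_hasDerivAt_nonneg hA hκ₀
  have hint : IntervalIntegrable (fun s => κ s * bieleckiWeight κ s) volume 0 t :=
    (hκ.mul (continuous_bieleckiWeight hκ)).intervalIntegrable _ _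
  rcases le_total 0 t with ht | ht
  · have hW : ∀ s ∈ uIcc 0 t, bieleckiWeight κ s = exp (A s) := fun s hs =>
      congrArg exp (abs_of_nonneg (hA₀.ge.trans (hA_mono (uIcc_of_le ht ▸ hs).1)))
    have hval : ∫ s in 0..t, κ s * bieleckiWeight κ s = exp (A t) - exp (A 0) :=
      intervalIntegral.integral_eq_sub_of_hasDerivAt
        (fun s hs => (hA s).exp.congr_deriv (by rw [hW s hs, mul_comm])) hint
    have hle := one_le_bieleckiWeight κ t
    rw [hW t right_mem_uIcc] at hle ⊢
    rw [hval, hA₀, exp_zero, abs_of_nonneg (by linarith)]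
    linarith
  · have hW : ∀ s ∈ uIcc 0 t, bieleckiWeight κ s = exp (-A s) := fun s hs =>
      congrArg exp (abs_of_nonpos ((hA_mono (uIcc_of_ge ht ▸ hs).2).trans hA₀.le))
    have hval : ∫ s in 0..t, κ s * bieleckiWeight κ s = -exp (-A t) - -exp (-A 0) :=
      intervalIntegral.integral_eq_sub_of_hasDerivAt
        (fun s hs => (hA s).fun_neg.exp.neg.congr_deriv (by rw [hW s hs]; ring)) hint
    have hle := one_le_bieleckiWeight κ t
    rw [hW t right_mem_uIcc] at hle ⊢
    rw [hval, hA₀, neg_zero, exp_zero, abs_of_nonpos (by linarith)]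
    linarith

theorem norm_integral_le_mul_bieleckiWeight {κ : ℝ → ℝ} (hκ : Continuous κ) (hκ₀ : ∀ t, 0 ≤ κ t)
    {f : ℝ → E} {C : ℝ} (hC : 0 ≤ C) (hf : ∀ s, ‖f s‖ ≤ C * (κ s * bieleckiWeight κ s)) (t : ℝ) :
    ‖∫ s in 0..t, f s‖ ≤ C * bieleckiWeight κ t := by
  have hint : Continuous fun s => C * (κ s * bieleckiWeight κ s) :=
    (hκ.mul (continuous_bieleckiWeight hκ)).const_mul C
  calc ‖∫ s in 0..t, f s‖ ≤ |(∫ s in 0..t, C * (κ s * bieleckiWeight κ s))| :=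
        intervalIntegral.norm_integral_le_abs_of_norm_le (ae_of_all _ fun s => hf s)
          (hint.intervalIntegrable _ _)
    _ = C * |(∫ s in 0..t, κ s * bieleckiWeight κ s)| := by
        rw [intervalIntegral.integral_const_mul, abs_mul, abs_of_nonneg hC]
    _ ≤ C * bieleckiWeight κ t := by
        gcongr
        exact abs_integral_mul_bieleckiWeight_le hκ hκ₀ t

theorem exists_bieleckiWeight_smul_eq [CompleteSpace E] {κ : ℝ → ℝ} (hκ : Continuous κ)
    (hκ₀ : ∀ t, 0 ≤ κ t) {u : ℝ → E → E} (hu : Continuous (uncurry u))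
    (hlip : ∀ t x y, ‖u t x - u t y‖ ≤ 1 / 2 * ‖x - y‖ * (κ t * bieleckiWeight κ t))
    (hgrowth : ∀ t x, ‖u t x‖ ≤ (1 + ‖x‖) * (κ t * bieleckiWeight κ t)) (x₀ : E) :
    ∃ g : ℝ →ᵇ E, ∀ t, bieleckiWeight κ t • g t = x₀ + ∫ s in 0..t, u s (g s) := by
  set W : ℝ → ℝ := bieleckiWeight κ
  have hW₁ : ∀ t, 1 ≤ W t := one_le_bieleckiWeight κ
  have hW₀ (t : ℝ) : 0 < W t := zero_lt_one.trans_le (hW₁ t)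
  have hκW (t : ℝ) : 0 ≤ κ t * W t := mul_nonneg (hκ₀ t) (hW₀ t).le
  have hu_cont (g : ℝ →ᵇ E) : Continuous fun s => u s (g s) :=
    hu.comp (by fun_prop : Continuous fun s => (s, g s))
  let Φ (g : ℝ →ᵇ E) : ℝ →ᵇ E := BoundedContinuousFunction.ofNormedAddCommGroup
    (fun t => (W t)⁻¹ • (x₀ + ∫ s in 0..t, u s (g s)))
    (((continuous_bieleckiWeight hκ).inv₀ fun t => (hW₀ t).ne').smul <| continuous_const.add <|
      intervalIntegral.continuous_primitive (fun a b => (hu_cont g).intervalIntegrable a b) 0)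
    (‖x₀‖ + (1 + ‖g‖)) fun t => by
      rw [norm_smul, norm_inv, Real.norm_of_nonneg (hW₀ t).le, inv_mul_le_iff₀ (hW₀ t)]
      have hint := norm_integral_le_mul_bieleckiWeight hκ hκ₀ (by positivity) (fun s =>
        (hgrowth s (g s)).trans (mul_le_mul_of_nonneg_right
          (add_le_add_right (g.norm_coe_le_norm s) 1) (hκW s))) t
      have hx₀ : ‖x₀‖ ≤ W t * ‖x₀‖ := le_mul_of_one_le_left (norm_nonneg _) (hW₁ t)
      have := norm_add_le x₀ (∫ s in 0..t, u s (g s))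
      linarith
  have hΦ : ContractingWith (1 / 2) Φ := by
    refine ⟨by rw [← NNReal.coe_lt_coe]; norm_num, LipschitzWith.of_dist_le_mul fun g h => ?_⟩
    rw [dist_eq_norm, dist_eq_norm]
    refine BoundedContinuousFunction.norm_le (by positivity) |>.2 fun t => ?_
    have hsub : (Φ g - Φ h) t = (W t)⁻¹ • ∫ s in 0..t, (u s (g s) - u s (h s)) := by
      rw [intervalIntegral.integral_sub ((hu_cont g).intervalIntegrable _ _)
        ((hu_cont h).intervalIntegrable _ _)]
      simp [Φ, ← smul_sub]
    rw [hsub, norm_smul, norm_inv, Real.norm_of_nonneg (hW₀ t).le, inv_mul_le_iff₀ (hW₀ t),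
      mul_comm]
    refine norm_integral_le_mul_bieleckiWeight hκ hκ₀ (by positivity) (fun s =>
      (hlip s _ _).trans (mul_le_mul_of_nonneg_right ?_ (hκW s))) t
    simpa using (g - h).norm_coe_le_norm s
  obtain ⟨g, hg, -⟩ := hΦ.exists_fixedPoint 0 (edist_ne_top _ _)
  refine ⟨g, fun t => ?_⟩
  conv_lhs => rw [← hg.eq]
  exact smul_inv_smul₀ (hW₀ t).ne' _

theorem exists_isIntegralCurve_of_lipschitzWith [CompleteSpace E] {v : ℝ → E → E} {k : ℝ → ℝ≥0}
    (hv : Continuous (uncurry v)) (hk : Continuous k) (hlip : ∀ t, LipschitzWith (k t) (v t))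
    (x₀ : E) : ∃ γ : ℝ → E, γ 0 = x₀ ∧ IsIntegralCurve γ v := by
  set κ : ℝ → ℝ := fun t => 2 * k t + ‖v t 0‖
  have hκ : Continuous κ := by
    have : Continuous fun t => v t 0 := hv.comp (by fun_prop : Continuous fun t : ℝ => (t, (0 : E)))
    fun_prop
  set W : ℝ → ℝ := bieleckiWeight κ
  have hW : Continuous W := continuous_bieleckiWeight hκ
  have hW₁ : ∀ t, 1 ≤ W t := one_le_bieleckiWeight κ
  have hW₀ (t : ℝ) : 0 ≤ W t := zero_le_one.trans (hW₁ t)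
  have hlip_smul (t : ℝ) (x y : E) : ‖v t (W t • x) - v t (W t • y)‖ ≤ k t * (W t * ‖x - y‖) :=
    ((hlip t).norm_sub_le _ _).trans_eq (by
      rw [← smul_sub, norm_smul, Real.norm_of_nonneg (hW₀ t)])
  have hgrowth (t : ℝ) (x : E) : ‖v t (W t • x)‖ ≤ (1 + ‖x‖) * (κ t * W t) := by
    have hdiff : ‖v t (W t • x) - v t 0‖ ≤ k t * (W t * ‖x‖) := by simpa using hlip_smul t x 0
    have hzero : ‖v t 0‖ ≤ ‖v t 0‖ * W t := le_mul_of_one_le_right (norm_nonneg _) (hW₁ t)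
    have hcross : 0 ≤ W t * ((2 + ‖x‖) * k t + ‖v t 0‖ * ‖x‖) :=
      mul_nonneg (hW₀ t) (by positivity)
    have := norm_le_insert' (v t (W t • x)) (v t 0)
    simp only [κ]
    linarith
  have hcontr (t : ℝ) (x y : E) :
      ‖v t (W t • x) - v t (W t • y)‖ ≤ 1 / 2 * ‖x - y‖ * (κ t * W t) := by
    have : 0 ≤ W t * (‖v t 0‖ * ‖x - y‖) := mul_nonneg (hW₀ t) (by positivity)
    refine (hlip_smul t x y).trans ?_
    simp only [κ]
    linarith
  have hu : Continuous (uncurry fun t x => v t (W t • x)) :=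
    hv.comp (by fun_prop : Continuous fun z : ℝ × E => (z.1, W z.1 • z.2))
  obtain ⟨g, hg⟩ := exists_bieleckiWeight_smul_eq hκ (fun t => by positivity) hu hcontr hgrowth x₀
  have hg_cont : Continuous fun t => v t (W t • g t) :=
    hu.comp (by fun_prop : Continuous fun t => (t, g t))
  refine ⟨fun t => W t • g t, (hg 0).trans (by rw [intervalIntegral.integral_same, add_zero]),
    fun t => ?_⟩
  exact ((hg_cont.integral_hasStrictDerivAt 0 t).hasDerivAt.const_add x₀).congr_of_eventuallyEq
    (.of_forall hg)

theorem eq_of_isIntegralCurve_of_lipschitzWith {v : ℝ → E → E} {k : ℝ → ℝ≥0}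
    (hk : Continuous k) (hlip : ∀ t, LipschitzWith (k t) (v t)) {γ γ' : ℝ → E}
    (hγ : IsIntegralCurve γ v) (hγ' : IsIntegralCurve γ' v) {t₀ : ℝ} (h : γ t₀ = γ' t₀) :
    γ = γ' := by
  funext t
  obtain ⟨a, ha⟩ := exists_lt (min t t₀)
  obtain ⟨b, hb⟩ := exists_gt (max t t₀)
  rw [lt_min_iff] at ha
  rw [max_lt_iff] at hb
  obtain ⟨K, hK⟩ := (isCompact_Icc (a := a) (b := b)).bddAbove_image hk.continuousOn
  refine ODE_solution_unique_of_mem_Ioo (v := v) (s := fun _ => univ) (K := K)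
    (fun s hs => ((hlip s).weaken ?_).lipschitzOnWith)
    ⟨ha.2, hb.2⟩ (fun s _ => ⟨hγ s, mem_univ _⟩) (fun s _ => ⟨hγ' s, mem_univ _⟩) h ⟨ha.1, hb.1⟩
  exact hK (mem_image_of_mem k (Ioo_subset_Icc_self hs))

end GlobalExistence

section SecondOrder

variable {G : ℝ → ℝ → ℝ} {x y : ℝ → ℝ}

theorem IsSolution.hasDerivAt (h : IsSolution G x) (t : ℝ) : HasDerivAt x (deriv x t) t :=
  (h.1 t).hasDerivAt

theorem IsSolution.continuous (h : IsSolution G x) : Continuous x :=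
  h.1.continuous

theorem IsSolution.continuous_deriv (h : IsSolution G x) : Continuous (deriv x) :=
  continuous_iff_continuousAt.2 fun t => (h.2 t).continuousAt

theorem IsSolution.congr_force {G' : ℝ → ℝ → ℝ} (h : IsSolution G x)
    (hG : ∀ t, G' (x t) t = G (x t) t) : IsSolution G' x :=
  ⟨h.1, fun t => hG t ▸ h.2 t⟩

theorem isSolution_of_hasDerivAt {v : ℝ → ℝ} (h : ∀ t, HasDerivAt x (v t) t)
    (h' : ∀ t, HasDerivAt v (-G (x t) t) t) : IsSolution G x ∧ deriv x = v := by
  have hv : deriv x = v := funext fun t => (h t).deriv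
  exact ⟨⟨fun t => (h t).differentiableAt, fun t => hv ▸ h' t⟩, hv⟩

theorem IsSolution.comp_add_const (h : IsSolution G x) (c : ℝ) :
    IsSolution (fun x t => G x (t + c)) fun t => x (t + c) :=
  (isSolution_of_hasDerivAt (fun t => (h.hasDerivAt (t + c)).comp_add_const t c)
    fun t => (h.2 (t + c)).comp_add_const t c).1

theorem IsSolution.comp_neg (h : IsSolution G x) :
    IsSolution (fun x t => G x (-t)) fun t => x (-t) :=
  (isSolution_of_hasDerivAt
    (fun t => ((h.hasDerivAt (-t)).scomp t (hasDerivAt_neg t)).congr_deriv (by simp))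
    fun t => ((h.2 (-t)).scomp t (hasDerivAt_neg t)).neg.congr_deriv (by simp)).1

theorem IsSolution.neg (h : IsSolution G x) :
    IsSolution (fun x t => -G (-x) t) fun t => -x t :=
  (isSolution_of_hasDerivAt (fun t => (h.hasDerivAt t).neg) fun t =>
    (h.2 t).neg.congr_deriv (by simp)).1

/-- A jointly continuous force `G(x,t)`, globally Lipschitz in the position `x` with a constant
depending continuously on the time `t`: the setting in which `x'' + G(x,t) = 0` is globally
uniquely solvable. -/
structure LipschitzForce (G : ℝ → ℝ → ℝ) : Prop where
  continuous : Continuous (uncurry G)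
  lipschitzWith : ∃ k : ℝ → ℝ≥0, Continuous k ∧ ∀ t, LipschitzWith (k t) (G · t)

theorem lipschitzWith_phaseField {k : ℝ → ℝ≥0}
    (hk : ∀ t, LipschitzWith (k t) (G · t)) (t : ℝ) :
    LipschitzWith (max 1 (k t)) fun z : ℝ × ℝ => (z.2, -G z.1 t) :=
  LipschitzWith.prod_snd.prodMk <|
    (((hk t).comp LipschitzWith.prod_fst).neg).weaken (mul_one (k t)).le

theorem LipschitzForce.exists_isSolution (hG : LipschitzForce G) (a b : ℝ) :
    ∃ x, IsSolution G x ∧ x 0 = a ∧ deriv x 0 = b := by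
  obtain ⟨k, hk_cont, hk⟩ := hG.lipschitzWith
  have hfield : Continuous (uncurry fun (t : ℝ) (z : ℝ × ℝ) => (z.2, -G z.1 t)) :=
    (by fun_prop : Continuous fun p : ℝ × (ℝ × ℝ) => p.2.2).prodMk
      (hG.continuous.comp (by fun_prop : Continuous fun p : ℝ × (ℝ × ℝ) => (p.2.1, p.1))).neg
  obtain ⟨γ, hγ₀, hγ⟩ := exists_isIntegralCurve_of_lipschitzWith hfield
    (continuous_const.max hk_cont) (lipschitzWith_phaseField hk) (a, b)
  obtain ⟨hsol, hderiv⟩ := isSolution_of_hasDerivAt (fun t => (hγ t).fst) (fun t => (hγ t).snd)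
  exact ⟨_, hsol, by simp [hγ₀], by simp [hderiv, hγ₀]⟩

theorem LipschitzForce.eq_of_isSolution (hG : LipschitzForce G) (hx : IsSolution G x)
    (hy : IsSolution G y) {t₀ : ℝ} (h : x t₀ = y t₀) (h' : deriv x t₀ = deriv y t₀) : x = y := by
  obtain ⟨k, hk_cont, hk⟩ := hG.lipschitzWith
  have hcurve {z : ℝ → ℝ} (hz : IsSolution G z) :
      IsIntegralCurve (fun t => (z t, deriv z t)) fun t z => (z.2, -G z.1 t) :=
    fun t => (hz.hasDerivAt t).prodMk (hz.2 t)
  have := eq_of_isIntegralCurve_of_lipschitzWith (continuous_const.max hk_cont)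
    (lipschitzWith_phaseField hk) (hcurve hx) (hcurve hy) (Prod.ext h h')
  exact funext fun t => congrArg Prod.fst (congrFun this t)

theorem lipschitzForce_affine {q g : ℝ → ℝ} (hq : Continuous q) (hg : Continuous g) :
    LipschitzForce fun x t => q t * x + g t where
  continuous := by unfold uncurry; fun_prop
  lipschitzWith := ⟨fun t => ‖q t‖₊, by fun_prop, fun t =>
    LipschitzWith.of_dist_le_mul fun x y => by simp [dist_eq_norm, ← mul_sub]⟩

theorem lipschitzForce_linear {q : ℝ → ℝ} (hq : Continuous q) :
    LipschitzForce fun x t => q t * x := by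
  simpa using lipschitzForce_affine hq continuous_zero

end SecondOrder

section Superposition

variable {X E F : Type*} [TopologicalSpace X] [NormedAddCommGroup E] [NormedAddCommGroup F]

/-- The superposition (Nemytskii) operator `z ↦ f ∘ z` on continuous functions, with value `0`
where `f ∘ z` is discontinuous. -/
def superpose (f : E → F) (z : C(X, E)) : C(X, F) :=
  ContinuousMap.mkD (f ∘ z) 0

theorem superpose_apply {f : E → F} {z : C(X, E)} (h : Continuous (f ∘ z)) (t : X) :
    superpose f z t = f (z t) :=
  ContinuousMap.mkD_apply_of_continuous h

theorem superpose_apply_of_continuousOn {f : E → F} {U : Set E} (hf : ContinuousOn f U)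
    {z : C(X, E)} (hz : ∀ t, z t ∈ U) (t : X) : superpose f z t = f (z t) :=
  superpose_apply (hf.comp_continuous z.continuous hz) t

variable [CompactSpace X] [NormedSpace ℝ E] [NormedSpace ℝ F]

theorem hasStrictFDerivAt_superpose {f : E → F} {U : Set E} (hU : IsOpen U)
    (hf : ContDiffOn ℝ 1 f U) {z : C(X, E)} (hz : ∀ t, z t ∈ U) {D : C(X, E) →L[ℝ] C(X, F)}
    (hD : ∀ y t, D y t = fderiv ℝ f (z t) (y t)) : HasStrictFDerivAt (superpose f) D z := by
  refine .of_isLittleO (Asymptotics.isLittleO_iff.2 fun ε hε => ?_)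
  have hK : IsCompact (range z) := isCompact_range z.continuous
  obtain ⟨δ₁, hδ₁, hδU⟩ := hK.exists_thickening_subset_open hU (range_subset_iff.2 hz)
  obtain ⟨δ₂, hδ₂, hδf⟩ := Metric.mem_uniformity_dist.1 <|
    hK.uniformContinuousAt_of_continuousAt (fderiv ℝ f)
      (forall_mem_range.2 fun t => (hf.continuousOn_fderiv_of_isOpen hU le_rfl).continuousAt
        (hU.mem_nhds (hz t))) (Metric.dist_mem_uniformity hε)
  have hball {t : X} {b : E} (hb : b ∈ Metric.ball (z t) (min δ₁ δ₂)) :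
      b ∈ U ∧ ‖fderiv ℝ f b - fderiv ℝ f (z t)‖ ≤ ε := by
    have hb := lt_min_iff.1 (Metric.mem_ball.1 hb)
    refine ⟨hδU (Metric.mem_thickening_iff.2 ⟨z t, mem_range_self t, hb.1⟩), ?_⟩
    rw [norm_sub_rev, ← dist_eq_norm]
    exact (hδf (by rw [dist_comm]; exact hb.2) (mem_range_self t)).le
  have hnear {y : C(X, E)} (hy : y ∈ Metric.ball z (min δ₁ δ₂)) (t : X) :
      y t ∈ Metric.ball (z t) (min δ₁ δ₂) :=
    (ContinuousMap.dist_apply_le_dist t).trans_lt hy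
  filter_upwards [prod_mem_nhds (Metric.ball_mem_nhds z (lt_min hδ₁ hδ₂))
    (Metric.ball_mem_nhds z (lt_min hδ₁ hδ₂))] with ⟨y, y'⟩ ⟨hy, hy'⟩
  refine (ContinuousMap.norm_le _ (by positivity)).2 fun t => ?_
  rw [ContinuousMap.sub_apply, ContinuousMap.sub_apply, hD,
    superpose_apply_of_continuousOn hf.continuousOn fun s => (hball (hnear hy s)).1,
    superpose_apply_of_continuousOn hf.continuousOn fun s => (hball (hnear hy' s)).1]
  refine ((convex_ball (z t) (min δ₁ δ₂)).norm_image_sub_le_of_norm_hasFDerivWithin_le'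
    (fun b hb => ((hf.differentiableOn one_ne_zero).differentiableAt
      (hU.mem_nhds (hball hb).1)).hasFDerivAt.hasFDerivWithinAt)
    (fun b hb => (hball hb).2) (hnear hy' t) (hnear hy t)).trans ?_
  gcongr
  exact (y - y').norm_coe_le_norm t

end Superposition

section ImplicitFunction

theorem exists_implicitFunction {P E F : Type*} [NormedAddCommGroup P] [NormedSpace ℝ P]
    [CompleteSpace P] [NormedAddCommGroup E] [NormedSpace ℝ E] [CompleteSpace E]
    [NormedAddCommGroup F] [NormedSpace ℝ F] [CompleteSpace F] {Φ : P × E → F}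
    {Φ' : P × E →L[ℝ] F} {z : P × E} (hΦ : HasStrictFDerivAt Φ Φ' z) (hz : Φ z = 0)
    {L : E →L[ℝ] F} (hL : L.IsInvertible) (hΦ'L : ∀ y, Φ' (0, y) = L y) :
    ∃ (ψ : P → E) (ξ : P →L[ℝ] E), HasStrictFDerivAt ψ ξ z.1 ∧
      (∀ᶠ p in 𝓝 z.1, Φ (p, ψ p) = 0) ∧ (∀ᶠ v in 𝓝 z, Φ v = 0 → ψ v.1 = v.2) ∧
      ∀ h y, Φ' (h, y) = 0 → ξ h = y := by
  have hinr : Φ' ∘L .inr ℝ P E = L := by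
    ext y
    exact hΦ'L y
  have hinv : (Φ' ∘L .inr ℝ P E).IsInvertible := hinr ▸ hL
  have hunique := hΦ.eventually_apply_eq_iff_implicitFunctionOfProdDomain hinv
  rw [hz] at hunique
  refine ⟨_, _, hΦ.hasStrictFDerivAt_implicitFunctionOfProdDomain hinv,
    hz ▸ hΦ.eventually_apply_implicitFunctionOfProdDomain hinv,
    hunique.mono fun v => Iff.mp, fun h y hy => ?_⟩
  have hsplit : Φ' (h, 0) = -L y := by
    rw [← hΦ'L, eq_neg_iff_add_eq_zero, ← map_add, Prod.mk_add_mk, add_zero, zero_add, hy]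
  simp [hinr, hsplit, hL.inverse_apply_eq]

end ImplicitFunction

section Volterra

variable {T : ℝ≥0}

/-- The restriction of `f` to `[0, T]` as an element of the Banach algebra `C([0, T])`
(and `0` if `f` is discontinuous). -/
def path (T : ℝ≥0) (f : ℝ → ℝ) : C(Icc (0 : ℝ) T, ℝ) :=
  ContinuousMap.mkD (fun t => f t) 0

theorem path_apply {f : ℝ → ℝ} (hf : Continuous f) (t : Icc (0 : ℝ) T) : path T f t = f t :=
  ContinuousMap.mkD_apply_of_continuous (hf.comp continuous_subtype_val)

/-- The primitive vanishing at `0`, as an operator on `C([0, T])`. -/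
def volterra (T : ℝ≥0) : C(Icc (0 : ℝ) T, ℝ) →L[ℝ] C(Icc (0 : ℝ) T, ℝ) :=
  LinearMap.mkContinuous
    { toFun := fun g => ⟨fun t => ∫ s in 0..(t : ℝ), IccExtend T.coe_nonneg g s,
        (intervalIntegral.continuous_primitive
          (fun a b => g.continuous.Icc_extend'.intervalIntegrable a b) 0).comp
          continuous_subtype_val⟩
      map_add' := fun g h => ContinuousMap.ext fun t => intervalIntegral.integral_add
        (g.continuous.Icc_extend'.intervalIntegrable _ _)
        (h.continuous.Icc_extend'.intervalIntegrable _ _)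
      map_smul' := fun c g => ContinuousMap.ext fun t =>
        intervalIntegral.integral_const_mul c _ } T fun g => by
    refine (ContinuousMap.norm_le _ (by positivity)).2 fun t => ?_
    refine (intervalIntegral.norm_integral_le_of_norm_le_const (C := ‖g‖)
      fun s _ => g.norm_coe_le_norm _).trans ?_
    rw [sub_zero, abs_of_nonneg t.2.1, mul_comm]
    gcongr
    exact t.2.2

theorem volterra_apply (g : C(Icc (0 : ℝ) T, ℝ)) (t : Icc (0 : ℝ) T) :
    volterra T g t = ∫ s in 0..(t : ℝ), IccExtend T.coe_nonneg g s :=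
  rfl

theorem volterra_path {x v : ℝ → ℝ} (hv : Continuous v) (hx : ∀ t, HasDerivAt x (v t) t) :
    volterra T (path T v) = path T x - x 0 • 1 := by
  ext t
  have hcongr : EqOn (IccExtend T.coe_nonneg (path T v)) v (uIcc 0 (t : ℝ)) := fun s hs => by
    rw [uIcc_of_le t.2.1] at hs
    rw [IccExtend_of_mem _ _ ⟨hs.1, hs.2.trans t.2.2⟩, path_apply hv]
  rw [volterra_apply, intervalIntegral.integral_congr hcongr,
    intervalIntegral.integral_eq_sub_of_hasDerivAt (fun s _ => hx s) (hv.intervalIntegrable _ _),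
    ContinuousMap.sub_apply,
    path_apply (continuous_iff_continuousAt.2 fun s => (hx s).continuousAt)]
  simp

theorem abs_volterra_le {g : C(Icc (0 : ℝ) T, ℝ)} {C l : ℝ} (hC : 0 ≤ C) (hl : 0 < l)
    (hg : ∀ s, |g s| ≤ C * exp (l * s)) (t : Icc (0 : ℝ) T) :
    |volterra T g t| ≤ C / l * exp (l * t) := by
  have hexp : ∫ s in 0..(t : ℝ), C * exp (l * s) = C / l * exp (l * t) - C / l := by
    rw [intervalIntegral.integral_const_mul, intervalIntegral.integral_comp_mul_left _ hl.ne']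
    simp
    ring
  have hint : ‖∫ s in 0..(t : ℝ), IccExtend T.coe_nonneg g s‖ ≤
      ∫ s in 0..(t : ℝ), C * exp (l * s) :=
    intervalIntegral.norm_integral_le_of_norm_le t.2.1 (ae_of_all _ fun s hs => by
      have hs : s ∈ Icc (0 : ℝ) T := ⟨hs.1.le, hs.2.trans t.2.2⟩
      rw [IccExtend_of_mem T.coe_nonneg g hs]
      exact hg ⟨s, hs⟩)
      ((by fun_prop : Continuous fun s => C * exp (l * s)).intervalIntegrable _ _)
  exact hint.trans (hexp.le.trans (sub_le_self _ (by positivity)))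

theorem abs_volterra_volterra_le {g : C(Icc (0 : ℝ) T, ℝ)} {C l : ℝ} (hC : 0 ≤ C) (hl : 0 < l)
    (hg : ∀ s, |g s| ≤ C * exp (l * s)) (t : Icc (0 : ℝ) T) :
    |volterra T (volterra T g) t| ≤ C / l ^ 2 * exp (l * t) := by
  have := abs_volterra_le (by positivity) hl (abs_volterra_le hC hl hg) t
  rwa [div_div, ← sq] at this

theorem eq_zero_of_eq_volterra_volterra {u g : C(Icc (0 : ℝ) T, ℝ)} {K : ℝ} (hK : 0 ≤ K)
    (hu : u = volterra T (volterra T g)) (hg : ∀ t, |g t| ≤ K * |u t|) : u = 0 := by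
  set l : ℝ := K + 1
  have hl : 0 < l := by positivity
  have : Nonempty (Icc (0 : ℝ) T) := ⟨⟨0, le_rfl, T.coe_nonneg⟩⟩
  obtain ⟨t₀, -, hmax⟩ := isCompact_univ.exists_isMaxOn univ_nonempty
    (by fun_prop : Continuous fun t : Icc (0 : ℝ) T => |u t| * exp (-(l * t))).continuousOn
  set M := |u t₀| * exp (-(l * t₀))
  have hM : 0 ≤ M := by positivity
  have hbound (t : Icc (0 : ℝ) T) : |u t| ≤ M * exp (l * t) := by
    have : |u t| * exp (-(l * t)) ≤ M := hmax (mem_univ t)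
    rwa [exp_neg, mul_inv_le_iff₀ (exp_pos _)] at this
  have himproved : M ≤ K * M / l ^ 2 := by
    have h := abs_volterra_volterra_le (g := g) (C := K * M) (by positivity) hl (fun t => by
      rw [mul_assoc]
      exact (hg t).trans (mul_le_mul_of_nonneg_left (hbound t) hK)) t₀
    rw [← hu] at h
    calc M = |u t₀| * exp (-(l * t₀)) := rfl
      _ ≤ K * M / l ^ 2 := by rwa [exp_neg, mul_inv_le_iff₀ (exp_pos _)]
  have hM₀ : M = 0 := by
    rw [le_div_iff₀ (by positivity)] at himproved
    have : l ^ 2 - K = K ^ 2 + K + 1 := by simp only [l]; ring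
    nlinarith [mul_nonneg hM hK, mul_nonneg hM (sq_nonneg K)]
  ext t
  simpa [hM₀] using hbound t

theorem isInvertible_one_add_of_norm_conj_lt_one {E : Type*} [NormedAddCommGroup E]
    [NormedSpace ℝ E] [CompleteSpace E] (W : (E →L[ℝ] E)ˣ) {B : E →L[ℝ] E}
    (hB : ‖↑W⁻¹ * B * ↑W‖ < 1) : (1 + B).IsInvertible := by
  have hunit : IsUnit (1 - -(↑W⁻¹ * B * ↑W)) := isUnit_one_sub_of_norm_lt_one (by rwa [norm_neg])
  obtain ⟨U, hU⟩ := (W.isUnit.mul hunit).mul W⁻¹.isUnit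
  exact ⟨.ofUnit U, hU.trans (by simp [mul_add, add_mul, mul_assoc])⟩

/-- Conjugation with a fast growing exponential makes `V² ∘ q` small, so the Neumann series
applies. -/
theorem isInvertible_one_add_volterra_volterra_mul (q : C(Icc (0 : ℝ) T, ℝ)) :
    (1 + (volterra T ∘L volterra T) ∘L ContinuousLinearMap.mul ℝ _ q).IsInvertible := by
  set B := (volterra T ∘L volterra T) ∘L ContinuousLinearMap.mul ℝ _ q
  set l : ℝ := ‖q‖ + 1
  have hl : 0 < l := by positivity
  let mulExp (c : ℝ) := ContinuousLinearMap.mul ℝ _ (path T fun t => exp (c * t))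
  have hmulExp (c : ℝ) (y : C(Icc (0 : ℝ) T, ℝ)) (t) : mulExp c y t = exp (c * t) * y t := by
    simp only [mulExp, ContinuousLinearMap.mul_apply', ContinuousMap.mul_apply]
    rw [path_apply (by fun_prop)]
  have hinv (c : ℝ) : mulExp c * mulExp (-c) = 1 := by
    ext y t
    simp [hmulExp, ← mul_assoc, ← exp_add]
  let W : (C(Icc (0 : ℝ) T, ℝ) →L[ℝ] C(Icc (0 : ℝ) T, ℝ))ˣ :=
    ⟨mulExp l, mulExp (-l), hinv l, by simpa using hinv (-l)⟩
  have hsmall : ‖↑W⁻¹ * B * ↑W‖ < 1 := by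
    have hlt : ‖q‖ / l ^ 2 < 1 := by
      rw [div_lt_one (by positivity)]
      simp only [l]
      nlinarith [norm_nonneg q]
    refine (ContinuousLinearMap.opNorm_le_bound _ (by positivity) fun y => ?_).trans_lt hlt
    refine (ContinuousMap.norm_le _ (by positivity)).2 fun t => ?_
    have hy := abs_volterra_volterra_le (g := q * mulExp l y) (C := ‖q‖ * ‖y‖) (by positivity) hl
      (fun s => by
        rw [ContinuousMap.mul_apply, hmulExp, abs_mul, abs_mul, abs_exp]
        have h₁ := q.norm_coe_le_norm s
        have h₂ := y.norm_coe_le_norm s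
        rw [Real.norm_eq_abs] at h₁ h₂
        calc |q s| * (exp (l * s) * |y s|) ≤ ‖q‖ * (exp (l * s) * ‖y‖) := by gcongr
          _ = _ := by ring) t
    change |mulExp (-l) (volterra T (volterra T (q * mulExp l y))) t| ≤ _
    rw [hmulExp, abs_mul, abs_exp, neg_mul, exp_neg, inv_mul_le_iff₀ (exp_pos _)]
    exact hy.trans_eq (by ring)
  exact isInvertible_one_add_of_norm_conj_lt_one W hsmall

end Volterra

section SmoothDependence

variable {T : ℝ≥0} {f : ℝ × ℝ → ℝ} {U : Set (ℝ × ℝ)}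

/-- The pairing `C([0, T]) × C([0, T]) → C([0, T], ℝ²)`. -/
def pairing (T : ℝ≥0) :
    C(Icc (0 : ℝ) T, ℝ) × C(Icc (0 : ℝ) T, ℝ) →L[ℝ] C(Icc (0 : ℝ) T, ℝ × ℝ) :=
  ((ContinuousLinearMap.inl ℝ ℝ ℝ).compLeftContinuous ℝ _).coprod
    ((ContinuousLinearMap.inr ℝ ℝ ℝ).compLeftContinuous ℝ _)

theorem pairing_apply (z : C(Icc (0 : ℝ) T, ℝ) × C(Icc (0 : ℝ) T, ℝ)) (t : Icc (0 : ℝ) T) :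
    pairing T z t = (z.1 t, z.2 t) := by
  simp [pairing]

theorem hasStrictFDerivAt_superpose_pairing (hU : IsOpen U) (hf : ContDiffOn ℝ 1 f U)
    {z : C(Icc (0 : ℝ) T, ℝ) × C(Icc (0 : ℝ) T, ℝ)} (hz : ∀ t, (z.1 t, z.2 t) ∈ U) :
    HasStrictFDerivAt (fun z => superpose f (pairing T z))
      ((ContinuousLinearMap.mul ℝ _ (superpose (fderiv ℝ f · (1, 0)) (pairing T z))).coprod
        (ContinuousLinearMap.mul ℝ _ (superpose (fderiv ℝ f · (0, 1)) (pairing T z)))) z := by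
  have hz' : ∀ t, pairing T z t ∈ U := fun t => pairing_apply z t ▸ hz t
  have hf' : ContinuousOn (fderiv ℝ f) U := hf.continuousOn_fderiv_of_isOpen hU le_rfl
  let D : C(Icc (0 : ℝ) T, ℝ × ℝ) →L[ℝ] C(Icc (0 : ℝ) T, ℝ) :=
    ContinuousLinearMap.mul ℝ _ (superpose (fderiv ℝ f · (1, 0)) (pairing T z)) ∘L
        (ContinuousLinearMap.fst ℝ ℝ ℝ).compLeftContinuous ℝ _ +
      ContinuousLinearMap.mul ℝ _ (superpose (fderiv ℝ f · (0, 1)) (pairing T z)) ∘L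
        (ContinuousLinearMap.snd ℝ ℝ ℝ).compLeftContinuous ℝ _
  have hD (y t) : D y t = fderiv ℝ f (pairing T z t) (y t) := by
    have hsplit : y t = (y t).1 • (1, 0) + (y t).2 • (0, 1) := by simp
    rw [hsplit, map_add, map_smul, map_smul]
    simp [D, superpose_apply_of_continuousOn (hf'.clm_apply continuousOn_const) hz', mul_comm]
  refine ((hasStrictFDerivAt_superpose hU hf hz' hD).comp z
    (pairing T).hasStrictFDerivAt).congr_fderiv ?_
  ext <;> simp [D, pairing]

theorem superpose_pairing_path {x ρ : ℝ → ℝ} (hx : Continuous x) (hρ : Continuous ρ)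
    (h : Continuous fun t => f (x t, ρ t)) :
    superpose f (pairing T (path T x, path T ρ)) = path T fun t => f (x t, ρ t) := by
  have hval (t : Icc (0 : ℝ) T) : pairing T (path T x, path T ρ) t = (x t, ρ t) := by
    rw [pairing_apply, path_apply hx, path_apply hρ]
  ext t
  rw [path_apply h, superpose_apply, hval]
  exact (h.comp continuous_subtype_val).congr fun t => by simp [hval]

theorem IsSolution.path_add_volterra {G : ℝ → ℝ → ℝ} {x : ℝ → ℝ} (hx : IsSolution G x)
    (hG : Continuous fun t => G (x t) t) :
    path T x + volterra T (volterra T (path T fun t => G (x t) t)) =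
        x 0 • 1 + deriv x 0 • path T id ∧
      path T (deriv x) + volterra T (path T fun t => G (x t) t) = deriv x 0 • 1 := by
  have hvel : path T (deriv x) + volterra T (path T fun t => G (x t) t) =
      deriv x 0 • 1 := by
    rw [volterra_path hG fun t => (hx.2 t).neg.congr_deriv (neg_neg _)]
    ext t
    simp [path_apply hx.continuous_deriv, path_apply hx.continuous_deriv.neg]
  have hconst : volterra T (deriv x 0 • 1) = deriv x 0 • path T id := by
    have hpath : path T (fun _ => deriv x 0) = deriv x 0 • 1 := by
      ext t
      simp [path_apply continuous_const]
    rw [← hpath, volterra_path continuous_const fun t =>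
      ((hasDerivAt_id t).const_mul (deriv x 0)).congr_deriv (mul_one _)]
    ext t
    simp [path_apply (by fun_prop : Continuous fun t => deriv x 0 * t), path_apply continuous_id]
  refine ⟨?_, hvel⟩
  rw [eq_sub_of_add_eq' hvel, map_sub, volterra_path hx.continuous_deriv hx.hasDerivAt, hconst]
  abel

theorem path_eq_of_add_volterra {ρ x : ℝ → ℝ} (hρ : Continuous ρ)
    (hforce : LipschitzForce fun x t => f (x, ρ t)) (hx : IsSolution (fun x t => f (x, ρ t)) x)
    {y : C(Icc (0 : ℝ) T, ℝ)}
    (hy : y + volterra T (volterra T (superpose f (pairing T (y, path T ρ)))) =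
      x 0 • 1 + deriv x 0 • path T id) : path T x = y := by
  obtain ⟨k, hk_cont, hk⟩ := hforce.lipschitzWith
  obtain ⟨K, hK⟩ := (isCompact_Icc (a := (0 : ℝ)) (b := T)).bddAbove_image hk_cont.continuousOn
  have hcont : Continuous fun t => f (x t, ρ t) :=
    hforce.continuous.comp (hx.continuous.prodMk continuous_id)
  have hy_cont : Continuous (f ∘ pairing T (y, path T ρ)) := by
    refine (hforce.continuous.comp (y.continuous.prodMk continuous_subtype_val)).congr fun t => ?_
    simp [uncurry, pairing_apply, path_apply hρ]
  rw [← sub_eq_zero]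
  refine eq_zero_of_eq_volterra_volterra (K := K) K.coe_nonneg
    (g := superpose f (pairing T (y, path T ρ)) - path T fun t => f (x t, ρ t)) ?_ fun t => ?_
  · rw [map_sub, map_sub, eq_sub_of_add_eq (hx.path_add_volterra hcont).1, eq_sub_of_add_eq' hy]
    abel
  · rw [ContinuousMap.sub_apply, ContinuousMap.sub_apply, superpose_apply hy_cont,
      path_apply hcont, pairing_apply, path_apply hρ, path_apply hx.continuous, abs_sub_comm (x t)]
    exact ((hk t).norm_sub_le _ _).trans
      (mul_le_mul_of_nonneg_right (hK (mem_image_of_mem k t.2)) (norm_nonneg _))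

variable {P : Type*} [NormedAddCommGroup P] [NormedSpace ℝ P]

theorem hasStrictFDerivAt_eval_path {x : P → ℝ → ℝ} {p₀ : P}
    (hx : ∀ᶠ p in 𝓝 p₀, Continuous (x p)) {ξ : P →L[ℝ] C(Icc (0 : ℝ) T, ℝ)}
    (hξ : HasStrictFDerivAt (fun p => path T (x p)) ξ p₀) (t : Icc (0 : ℝ) T) :
    HasStrictFDerivAt (fun p => x p t) (ContinuousMap.evalCLM ℝ t ∘L ξ) p₀ := by
  refine ((ContinuousMap.evalCLM ℝ t).hasStrictFDerivAt.comp p₀ hξ).congr_of_eventuallyEq ?_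
  filter_upwards [hx] with p hx
  exact path_apply hx t

theorem hasStrictDerivAt_eval_path {x : ℝ → ℝ → ℝ} {e₀ : ℝ}
    (hx : ∀ᶠ e in 𝓝 e₀, Continuous (x e)) {w : ℝ → ℝ} (hw : Continuous w)
    (hxw : HasStrictDerivAt (fun e => path T (x e)) (path T w) e₀) (t : Icc (0 : ℝ) T) :
    HasStrictDerivAt (fun e => x e t) (w t) e₀ := by
  have h := (hasStrictFDerivAt_eval_path hx hxw.hasStrictFDerivAt t).hasStrictDerivAt
  exact h.congr_deriv (by simp [path_apply hw])

variable [CompleteSpace P]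

/-- The equation `x'' + f(x, ρ) = 0` is solved in its integrated form
`x + V² f(x, ρ) = x(0) + x'(0) t`, `V` the Volterra operator. -/
theorem exists_implicit_path (hU : IsOpen U) (hf : ContDiffOn ℝ 1 f U)
    {R : P → C(Icc (0 : ℝ) T, ℝ)} {A B : P → ℝ} {p₀ : P} {x₀ : C(Icc (0 : ℝ) T, ℝ)}
    (hU₀ : ∀ t, (x₀ t, R p₀ t) ∈ U)
    (hx₀ : x₀ + volterra T (volterra T (superpose f (pairing T (x₀, R p₀)))) =
      A p₀ • 1 + B p₀ • path T id)
    {R' : P →L[ℝ] C(Icc (0 : ℝ) T, ℝ)} (hR : HasStrictFDerivAt R R' p₀)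
    {a b : P →L[ℝ] ℝ} (ha : HasStrictFDerivAt A a p₀) (hb : HasStrictFDerivAt B b p₀) :
    ∃ (ψ : P → C(Icc (0 : ℝ) T, ℝ)) (ξ : P →L[ℝ] C(Icc (0 : ℝ) T, ℝ)),
      HasStrictFDerivAt ψ ξ p₀ ∧
      (∀ᶠ p in 𝓝 p₀, ψ p + volterra T (volterra T (superpose f (pairing T (ψ p, R p)))) =
        A p • 1 + B p • path T id) ∧
      ∀ h y, y + volterra T (volterra T
          (superpose (fderiv ℝ f · (1, 0)) (pairing T (x₀, R p₀)) * y +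
            superpose (fderiv ℝ f · (0, 1)) (pairing T (x₀, R p₀)) * R' h)) =
        a h • 1 + b h • path T id → ξ h = y := by
  set V := volterra T
  set q := superpose (fderiv ℝ f · (1, 0)) (pairing T (x₀, R p₀))
  set c := superpose (fderiv ℝ f · (0, 1)) (pairing T (x₀, R p₀))
  let Φ (u : P × C(Icc (0 : ℝ) T, ℝ)) : C(Icc (0 : ℝ) T, ℝ) :=
    u.2 + V (V (superpose f (pairing T (u.2, R u.1)))) - (A u.1 • 1 + B u.1 • path T id)
  have hfst : HasStrictFDerivAt Prod.fst (.fst ℝ P C(Icc (0 : ℝ) T, ℝ)) (p₀, x₀) :=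
    hasStrictFDerivAt_fst
  have hsnd : HasStrictFDerivAt Prod.snd (.snd ℝ P C(Icc (0 : ℝ) T, ℝ)) (p₀, x₀) :=
    hasStrictFDerivAt_snd
  have hS := (hasStrictFDerivAt_superpose_pairing hU hf (z := (x₀, R p₀)) hU₀).comp (p₀, x₀)
    (f := fun u : P × C(Icc (0 : ℝ) T, ℝ) => (u.2, R u.1)) (hsnd.prodMk (hR.comp (p₀, x₀) hfst))
  have hΦ := (hsnd.add ((V ∘L V).hasStrictFDerivAt.comp (p₀, x₀) hS)).sub
    (((ha.comp (p₀, x₀) hfst).smul_const (1 : C(Icc (0 : ℝ) T, ℝ))).add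
      ((hb.comp (p₀, x₀) hfst).smul_const (path T id)))
  set Φ' := _
  change HasStrictFDerivAt Φ Φ' (p₀, x₀) at hΦ
  have hΦ'_apply (h : P) (y : C(Icc (0 : ℝ) T, ℝ)) :
      Φ' (h, y) = y + V (V (q * y + c * R' h)) - (a h • 1 + b h • path T id) := by
    rfl
  have hΦ₀ : Φ (p₀, x₀) = 0 := sub_eq_zero.2 hx₀
  obtain ⟨ψ, ξ, hψ, hsol, -, hξ⟩ := exists_implicitFunction hΦ hΦ₀
    (isInvertible_one_add_volterra_volterra_mul q) fun y => by simp [hΦ'_apply, V]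
  exact ⟨ψ, ξ, hψ, hsol.mono fun p hp => sub_eq_zero.1 hp, fun h y hy =>
    hξ h y ((hΦ'_apply h y).trans (sub_eq_zero.2 hy))⟩

theorem continuous_fderiv_apply (hU : IsOpen U) (hf : ContDiffOn ℝ 1 f U) {x ρ w η : ℝ → ℝ}
    (hx : Continuous x) (hρ : Continuous ρ) (hmem : ∀ t, (x t, ρ t) ∈ U) (hw : Continuous w)
    (hη : Continuous η) : Continuous fun t => fderiv ℝ f (x t, ρ t) (w t, η t) :=
  ((hf.continuousOn_fderiv_of_isOpen hU le_rfl).comp_continuous (hx.prodMk hρ) hmem).clm_apply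
    (hw.prodMk hη)

theorem path_fderiv_apply (hU : IsOpen U) (hf : ContDiffOn ℝ 1 f U) {x ρ w η : ℝ → ℝ}
    (hx : Continuous x) (hρ : Continuous ρ) (hmem : ∀ t, (x t, ρ t) ∈ U) (hw : Continuous w)
    (hη : Continuous η) :
    path T (fun t => fderiv ℝ f (x t, ρ t) (w t, η t)) =
      superpose (fderiv ℝ f · (1, 0)) (pairing T (path T x, path T ρ)) * path T w +
        superpose (fderiv ℝ f · (0, 1)) (pairing T (path T x, path T ρ)) * path T η := by
  have hpartial (v : ℝ × ℝ) : superpose (fderiv ℝ f · v) (pairing T (path T x, path T ρ)) =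
      path T fun t => fderiv ℝ f (x t, ρ t) v :=
    superpose_pairing_path hx hρ (continuous_fderiv_apply hU hf hx hρ hmem continuous_const
      continuous_const)
  ext t
  have hsplit : (w t, η t) = w t • ((1 : ℝ), (0 : ℝ)) + η t • ((0 : ℝ), (1 : ℝ)) := by simp
  simp only [hpartial, ContinuousMap.add_apply, ContinuousMap.mul_apply]
  rw [path_apply hw, path_apply hη, path_apply (continuous_fderiv_apply hU hf hx hρ hmem hw hη),
    path_apply (continuous_fderiv_apply hU hf hx hρ hmem continuous_const continuous_const),
    path_apply (continuous_fderiv_apply hU hf hx hρ hmem continuous_const continuous_const),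
    hsplit, map_add, map_smul, map_smul, smul_eq_mul, smul_eq_mul]
  ring

theorem exists_hasStrictFDerivAt_path (hU : IsOpen U) (hf : ContDiffOn ℝ 1 f U)
    {ρ x : P → ℝ → ℝ} {p₀ : P} (hmem : ∀ t, (x p₀ t, ρ p₀ t) ∈ U)
    (hρ : ∀ᶠ p in 𝓝 p₀, Continuous (ρ p))
    (hforce : ∀ᶠ p in 𝓝 p₀, LipschitzForce fun x t => f (x, ρ p t))
    (hx : ∀ᶠ p in 𝓝 p₀, IsSolution (fun x t => f (x, ρ p t)) (x p))
    {ρ' : P →L[ℝ] C(Icc (0 : ℝ) T, ℝ)} (hρ' : HasStrictFDerivAt (fun p => path T (ρ p)) ρ' p₀)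
    {a b : P →L[ℝ] ℝ} (ha : HasStrictFDerivAt (fun p => x p 0) a p₀)
    (hb : HasStrictFDerivAt (fun p => deriv (x p) 0) b p₀) :
    ∃ ξ ξ' : P →L[ℝ] C(Icc (0 : ℝ) T, ℝ), HasStrictFDerivAt (fun p => path T (x p)) ξ p₀ ∧
      HasStrictFDerivAt (fun p => path T (deriv (x p))) ξ' p₀ ∧
      ∀ h η w, Continuous η → ρ' h = path T η →
        IsSolution (fun y t => fderiv ℝ f (x p₀ t, ρ p₀ t) (y, η t)) w →
        w 0 = a h → deriv w 0 = b h → ξ h = path T w ∧ ξ' h = path T (deriv w) := by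
  have hcont : ∀ᶠ p in 𝓝 p₀, Continuous fun t => f (x p t, ρ p t) := by
    filter_upwards [hforce, hx] with p hforce hx
    exact hforce.continuous.comp (hx.continuous.prodMk continuous_id)
  have hρ₀ := hρ.self_of_nhds
  have hx₀ := hx.self_of_nhds.continuous
  have hmem' (t : Icc (0 : ℝ) T) : (path T (x p₀) t, path T (ρ p₀) t) ∈ U := by
    rw [path_apply hx₀, path_apply hρ₀]
    exact hmem t
  obtain ⟨ψ, ξ, hψ, hψ_eq, hξ⟩ := exists_implicit_path (R := fun p => path T (ρ p))
    (A := fun p => x p 0) (B := fun p => deriv (x p) 0) hU hf hmem'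
    (by
      rw [superpose_pairing_path hx₀ hρ₀ hcont.self_of_nhds]
      exact (hx.self_of_nhds.path_add_volterra hcont.self_of_nhds).1) hρ' ha hb
  have hpath : HasStrictFDerivAt (fun p => path T (x p)) ξ p₀ := by
    refine hψ.congr_of_eventuallyEq ?_
    filter_upwards [hρ, hforce, hx, hψ_eq] with p hρ hforce hx hψ
    exact (path_eq_of_add_volterra hρ hforce hx hψ).symm
  have hvel := (hb.smul_const (1 : C(Icc (0 : ℝ) T, ℝ))).sub
    ((volterra T).hasStrictFDerivAt.comp p₀
      ((hasStrictFDerivAt_superpose_pairing hU hf (z := (path T (x p₀), path T (ρ p₀))) hmem').comp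
        p₀ (hpath.prodMk hρ')))
  refine ⟨ξ, _, hpath, hvel.congr_of_eventuallyEq ?_, fun h η w hη hh hw hw₀ hw₁ => ?_⟩
  · filter_upwards [hρ, hx, hcont] with p hρ hx hcont
    rw [eq_sub_of_add_eq (hx.path_add_volterra hcont).2,
      ← superpose_pairing_path hx.continuous hρ hcont]
    rfl
  · have hw_eq := hw.path_add_volterra (T := T)
      (continuous_fderiv_apply hU hf hx₀ hρ₀ hmem hw.continuous hη)
    rw [path_fderiv_apply hU hf hx₀ hρ₀ hmem hw.continuous hη, ← hh, hw₀, hw₁] at hw_eq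
    have hξw := hξ h _ hw_eq.1
    refine ⟨hξw, ?_⟩
    rw [eq_sub_of_add_eq hw_eq.2, ← hξw]
    rfl

theorem hasStrictDerivAt_path_of_isSolution (hU : IsOpen U) (hf : ContDiffOn ℝ 1 f U)
    {ρ x : ℝ → ℝ → ℝ} {e₀ : ℝ} (hmem : ∀ t, (x e₀ t, ρ e₀ t) ∈ U)
    (hρ : ∀ᶠ e in 𝓝 e₀, Continuous (ρ e))
    (hforce : ∀ᶠ e in 𝓝 e₀, LipschitzForce fun x t => f (x, ρ e t))
    (hx : ∀ᶠ e in 𝓝 e₀, IsSolution (fun x t => f (x, ρ e t)) (x e)) {η w : ℝ → ℝ}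
    (hη : Continuous η) (hρ' : HasStrictDerivAt (fun e => path T (ρ e)) (path T η) e₀)
    (hw : IsSolution (fun y t => fderiv ℝ f (x e₀ t, ρ e₀ t) (y, η t)) w)
    (hw₀ : HasStrictDerivAt (fun e => x e 0) (w 0) e₀)
    (hw₁ : HasStrictDerivAt (fun e => deriv (x e) 0) (deriv w 0) e₀) :
    HasStrictDerivAt (fun e => path T (x e)) (path T w) e₀ ∧
      HasStrictDerivAt (fun e => path T (deriv (x e))) (path T (deriv w)) e₀ := by
  obtain ⟨ξ, ξ', hξ, hξ', h⟩ := exists_hasStrictFDerivAt_path hU hf hmem hρ hforce hx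
    hρ'.hasStrictFDerivAt hw₀.hasStrictFDerivAt hw₁.hasStrictFDerivAt
  obtain ⟨hξw, hξ'w⟩ := h 1 η w hη (by simp) hw (by simp) (by simp)
  exact ⟨hξw ▸ hξ.hasStrictDerivAt, hξ'w ▸ hξ'.hasStrictDerivAt⟩

theorem hasStrictDerivAt_path_comp (hU : IsOpen U) (hf : ContDiffOn ℝ 1 f U)
    {ρ x : ℝ → ℝ → ℝ} {e₀ : ℝ} (hmem : ∀ t, (x e₀ t, ρ e₀ t) ∈ U)
    (hx : ∀ᶠ e in 𝓝 e₀, Continuous (x e)) (hρ : ∀ᶠ e in 𝓝 e₀, Continuous (ρ e))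
    (hcont : ∀ᶠ e in 𝓝 e₀, Continuous fun t => f (x e t, ρ e t)) {η w : ℝ → ℝ}
    (hw : Continuous w) (hη : Continuous η)
    (hx' : HasStrictDerivAt (fun e => path T (x e)) (path T w) e₀)
    (hρ' : HasStrictDerivAt (fun e => path T (ρ e)) (path T η) e₀) :
    HasStrictDerivAt (fun e => path T fun t => f (x e t, ρ e t))
      (path T fun t => fderiv ℝ f (x e₀ t, ρ e₀ t) (w t, η t)) e₀ := by
  have hx₀ := hx.self_of_nhds
  have hρ₀ := hρ.self_of_nhds
  have hmem' (t : Icc (0 : ℝ) T) : (path T (x e₀) t, path T (ρ e₀) t) ∈ U := by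
    rw [path_apply hx₀, path_apply hρ₀]
    exact hmem t
  have h := (hasStrictFDerivAt_superpose_pairing hU hf
    (z := (path T (x e₀), path T (ρ e₀))) hmem').comp_hasStrictDerivAt e₀ (hx'.prodMk hρ')
  rw [path_fderiv_apply hU hf hx₀ hρ₀ hmem hw hη]
  refine h.congr_of_eventuallyEq ?_
  filter_upwards [hx, hρ, hcont] with e hx hρ hcont
  exact superpose_pairing_path hx hρ hcont

end SmoothDependence

section Kepler

variable {e : ℝ}

theorem eccentricAnomaly_zero (t : ℝ) : eccentricAnomaly t 0 = t := by
  simpa using eccentricAnomaly_spec t 0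

theorem eccentricAnomaly_neg (he : |e| < 1) (t : ℝ) :
    eccentricAnomaly (-t) e = -eccentricAnomaly t e := by
  refine (eccentricAnomaly_unique he ?_).symm
  rw [sin_neg]
  linarith [eccentricAnomaly_spec t e]

theorem eccentricAnomaly_add_two_pi (he : |e| < 1) (t : ℝ) :
    eccentricAnomaly (t + 2 * π) e = eccentricAnomaly t e + 2 * π := by
  refine (eccentricAnomaly_unique he ?_).symm
  rw [sin_add_two_pi]
  linarith [eccentricAnomaly_spec t e]

theorem continuous_eccentricAnomaly (he : |e| < 1) : Continuous (eccentricAnomaly · e) := by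
  have hlip : LipschitzWith ‖e‖₊ fun u => -(e * sin u) :=
    ((lipschitzWith_smul e).comp lipschitzWith_sin).neg.weaken (by simp)
  have hanti := AntilipschitzWith.id.add_lipschitzWith hlip
    (by simpa [← NNReal.coe_lt_coe] using he)
  exact (hanti.to_rightInverse fun t => by
    simpa [sub_eq_add_neg] using eccentricAnomaly_spec t e).continuous

theorem radius_zero (t : ℝ) : radius t 0 = 1 / 2 := by
  simp [radius]

theorem radius_neg (he : |e| < 1) (t : ℝ) : radius (-t) e = radius t e := by
  simp [radius, eccentricAnomaly_neg he]

theorem radius_periodic (he : |e| < 1) : Periodic (radius · e) (2 * π) := fun t => by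
  simp [radius, eccentricAnomaly_add_two_pi he]

theorem continuous_radius (he : |e| < 1) : Continuous (radius · e) := by
  have := continuous_eccentricAnomaly he
  unfold radius
  fun_prop

theorem radius_pos (he : |e| < 1) (t : ℝ) : 0 < radius t e := by
  have h : |e * cos (eccentricAnomaly t e)| < 1 := by
    rw [abs_mul]
    exact (mul_le_of_le_one_right (abs_nonneg e) (abs_cos_le_one _)).trans_lt he
  simp only [radius]
  linarith [(abs_lt.1 h).2]

theorem eventually_abs_lt_one : ∀ᶠ e : ℝ in 𝓝 0, |e| < 1 :=
  (continuous_abs.tendsto' 0 0 abs_zero).eventually_lt_const one_pos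

theorem hasStrictFDerivAt_superpose_real {X : Type*} [TopologicalSpace X] [CompactSpace X]
    {f : ℝ → ℝ} (hf : ContDiff ℝ 1 f) (z : C(X, ℝ)) :
    HasStrictFDerivAt (superpose f) (ContinuousLinearMap.mul ℝ _ (superpose (deriv f) z)) z :=
  hasStrictFDerivAt_superpose isOpen_univ hf.contDiffOn (fun _ => mem_univ _) fun y t => by
    simp [superpose_apply ((hf.continuous_deriv le_rfl).comp z.continuous), mul_comm]

variable {T : ℝ≥0}

theorem exists_hasStrictFDerivAt_path_eccentricAnomaly :
    ∃ u' : ℝ →L[ℝ] C(Icc (0 : ℝ) T, ℝ),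
      HasStrictFDerivAt (fun e => path T (eccentricAnomaly · e)) u' 0 := by
  let Φ (z : ℝ × C(Icc (0 : ℝ) T, ℝ)) := z.2 - z.1 • superpose sin z.2 - path T id
  have hfst : HasStrictFDerivAt Prod.fst (.fst ℝ ℝ C(Icc (0 : ℝ) T, ℝ)) (0, path T id) :=
    hasStrictFDerivAt_fst
  have hsnd : HasStrictFDerivAt Prod.snd (.snd ℝ ℝ C(Icc (0 : ℝ) T, ℝ)) (0, path T id) :=
    hasStrictFDerivAt_snd
  have hΦ := (hsnd.sub (hfst.smul ((hasStrictFDerivAt_superpose_real contDiff_sin _).comp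
    (0, path T id) hsnd))).sub_const (path T id)
  obtain ⟨ψ, u', hψ, hψ_eq, -⟩ := exists_implicitFunction (Φ := Φ) hΦ (by simp [Φ])
    (L := 1) ⟨.refl ℝ _, rfl⟩ fun y => by simp
  refine ⟨u', hψ.congr_of_eventuallyEq ?_⟩
  filter_upwards [hψ_eq, eventually_abs_lt_one] with e heq he
  ext t
  have hkepler := congrArg (· t) heq
  simp only [Φ, ContinuousMap.sub_apply, ContinuousMap.smul_apply, ContinuousMap.zero_apply,
    superpose_apply (continuous_sin.comp (ψ e).continuous), path_apply continuous_id,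
    smul_eq_mul, id, sub_eq_zero] at hkepler
  rw [eccentricAnomaly_unique he hkepler, path_apply (continuous_eccentricAnomaly he)]

theorem hasStrictDerivAt_path_radius :
    HasStrictDerivAt (fun e => path T (radius · e)) (path T fun t => -(1 / 2) * cos t) 0 := by
  obtain ⟨u', hu⟩ := exists_hasStrictFDerivAt_path_eccentricAnomaly (T := T)
  have hcos := (hasStrictFDerivAt_superpose_real contDiff_cos _).comp 0 hu
  have h := (((hasStrictFDerivAt_id (0 : ℝ)).smul hcos).const_sub 1).const_smul (1 / 2 : ℝ)
  refine ((hasStrictDerivAt_iff_hasStrictFDerivAt.2 (h.congr_fderiv ?_))).congr_of_eventuallyEq ?_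
  · ext t
    rw [ContinuousLinearMap.toSpanSingleton_apply, ContinuousMap.smul_apply,
      path_apply (by fun_prop : Continuous fun t => -(1 / 2) * cos t)]
    simp [superpose_apply (continuous_cos.comp (ContinuousMap.continuous _)),
      eccentricAnomaly_zero, path_apply continuous_id']
  · filter_upwards [eventually_abs_lt_one] with e he
    ext t
    rw [path_apply (continuous_radius he)]
    simp [superpose_apply (continuous_cos.comp (ContinuousMap.continuous _)),
      path_apply (continuous_eccentricAnomaly he), radius]

end Kepler

section Attraction

variable {x r : ℝ}

/-- The inverse distance between `(x, 0)` and `(0, r)`. -/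
def invDist (x r : ℝ) : ℝ :=
  (√(x ^ 2 + r ^ 2))⁻¹

/-- The attraction `x (x² + r²)^{-3/2}` of the primaries as a function of their distance `r` to
the origin. -/
def attraction (x r : ℝ) : ℝ :=
  x * invDist x r ^ 3

/-- The partial derivative of `attraction` in `x`. -/
def attractionX (x r : ℝ) : ℝ :=
  invDist x r ^ 3 - 3 * x ^ 2 * invDist x r ^ 5

/-- The partial derivative of `attraction` in `r`. -/
def attractionR (x r : ℝ) : ℝ :=
  -3 * x * r * invDist x r ^ 5

/-- The second partial derivative of `attraction` in `x`. -/
def attractionXX (x r : ℝ) : ℝ :=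
  -9 * x * invDist x r ^ 5 + 15 * x ^ 3 * invDist x r ^ 7

/-- The mixed second partial derivative of `attraction`. -/
def attractionXR (x r : ℝ) : ℝ :=
  -3 * r * invDist x r ^ 5 + 15 * x ^ 2 * r * invDist x r ^ 7

theorem force_eq_attraction (x t e : ℝ) : force x t e = attraction x (radius t e) := by
  rw [force, attraction, invDist, div_eq_mul_inv, inv_pow, sqrt_eq_rpow,
    ← rpow_mul_natCast (by positivity)]
  norm_num

theorem invDist_pos (hr : 0 < r) : 0 < invDist x r := by
  unfold invDist
  positivity

theorem invDist_sq_mul (hr : 0 < r) : invDist x r ^ 2 * (x ^ 2 + r ^ 2) = 1 := by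
  rw [invDist, inv_pow, sq_sqrt (by positivity)]
  field_simp

theorem invDist_neg (x r : ℝ) : invDist (-x) r = invDist x r := by
  simp [invDist]

theorem attraction_neg (x r : ℝ) : attraction (-x) r = -attraction x r := by
  simp [attraction, invDist_neg]

theorem attractionX_neg (x r : ℝ) : attractionX (-x) r = attractionX x r := by
  simp [attractionX, invDist_neg]

theorem invDist_lt {y : ℝ} (hr : 0 < r) (hy : 0 ≤ y) (h : y < x) :
    invDist x r < invDist y r := by
  unfold invDist
  gcongr

theorem attraction_pos (hr : 0 < r) (hx : 0 < x) : 0 < attraction x r := by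
  have := invDist_pos (x := x) hr
  unfold attraction
  positivity

theorem attraction_half_lt_four (x : ℝ) : attraction x (1 / 2) < 4 := by
  have hsq := invDist_sq_mul (x := x) one_half_pos
  have hpos := invDist_pos (x := x) one_half_pos
  have hlt : x * invDist x (1 / 2) < 1 := by nlinarith
  calc attraction x (1 / 2) = x * invDist x (1 / 2) * invDist x (1 / 2) ^ 2 := by
        rw [attraction]; ring
    _ < 1 * invDist x (1 / 2) ^ 2 := by gcongr
    _ ≤ 4 := by nlinarith [sq_nonneg (x * invDist x (1 / 2))]

theorem hasDerivAt_invDist_fst (hr : 0 < r) :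
    HasDerivAt (invDist · r) (-x * invDist x r ^ 3) x := by
  have hS : 0 < x ^ 2 + r ^ 2 := by positivity
  have h := ((((hasDerivAt_id' x).fun_pow 2).add_const (r ^ 2)).sqrt hS.ne').inv (sqrt_pos.2 hS).ne'
  refine h.congr_deriv ?_
  have := sqrt_pos.2 hS
  simp only [invDist]
  field_simp
  simp

theorem hasDerivAt_invDist_snd (hr : 0 < r) :
    HasDerivAt (invDist x ·) (-r * invDist x r ^ 3) r := by
  have hS : 0 < x ^ 2 + r ^ 2 := by positivity
  have h := ((((hasDerivAt_id' r).fun_pow 2).const_add (x ^ 2)).sqrt hS.ne').inv (sqrt_pos.2 hS).ne'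
  refine h.congr_deriv ?_
  have := sqrt_pos.2 hS
  simp only [invDist]
  field_simp
  simp

theorem hasDerivAt_attraction_fst (hr : 0 < r) :
    HasDerivAt (attraction · r) (attractionX x r) x := by
  refine ((hasDerivAt_id' x).mul ((hasDerivAt_invDist_fst hr).fun_pow 3)).congr_deriv ?_
  simp only [attractionX]
  push_cast
  ring

theorem hasDerivAt_attraction_snd (hr : 0 < r) :
    HasDerivAt (attraction x ·) (attractionR x r) r := by
  refine (((hasDerivAt_invDist_snd hr).fun_pow 3).const_mul x).congr_deriv ?_
  simp only [attractionR]
  push_cast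
  ring

theorem hasDerivAt_attractionX_fst (hr : 0 < r) :
    HasDerivAt (attractionX · r) (attractionXX x r) x := by
  refine (((hasDerivAt_invDist_fst hr).fun_pow 3).sub ((((hasDerivAt_id' x).fun_pow 2).const_mul
    3).mul ((hasDerivAt_invDist_fst hr).fun_pow 5))).congr_deriv ?_
  simp only [attractionXX]
  push_cast
  ring

theorem hasDerivAt_attractionX_snd (hr : 0 < r) :
    HasDerivAt (attractionX x ·) (attractionXR x r) r := by
  refine (((hasDerivAt_invDist_snd hr).fun_pow 3).sub
    (((hasDerivAt_invDist_snd hr).fun_pow 5).const_mul (3 * x ^ 2))).congr_deriv ?_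
  simp only [attractionXR]
  push_cast
  ring

theorem hasDerivAt_attractionR_fst (hr : 0 < r) :
    HasDerivAt (attractionR · r) (attractionXR x r) x := by
  refine ((((hasDerivAt_id' x).const_mul (-3)).mul_const r).mul
    ((hasDerivAt_invDist_fst hr).fun_pow 5)).congr_deriv ?_
  simp only [attractionXR]
  push_cast
  ring

theorem isOpen_setOf_snd_pos : IsOpen {z : ℝ × ℝ | 0 < z.2} :=
  isOpen_lt continuous_const continuous_snd

theorem contDiffOn_invDist : ContDiffOn ℝ 1 (fun z : ℝ × ℝ => invDist z.1 z.2) {z | 0 < z.2} := by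
  refine (((contDiff_fst.pow 2).add (contDiff_snd.pow 2)).contDiffOn.sqrt fun z hz => ?_).inv
    fun z hz => ?_ <;> have : 0 < z.2 := hz <;> positivity

theorem contDiffOn_attraction :
    ContDiffOn ℝ 1 (fun z : ℝ × ℝ => attraction z.1 z.2) {z | 0 < z.2} :=
  contDiffOn_fst.mul (contDiffOn_invDist.pow 3)

theorem contDiffOn_attractionX :
    ContDiffOn ℝ 1 (fun z : ℝ × ℝ => attractionX z.1 z.2) {z | 0 < z.2} :=
  (contDiffOn_invDist.pow 3).sub
    ((contDiffOn_const.mul (contDiffOn_fst.pow 2)).mul (contDiffOn_invDist.pow 5))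

theorem fderiv_apply_eq_of_hasDerivAt {f : ℝ × ℝ → ℝ} {z : ℝ × ℝ} {fx fr : ℝ}
    (hf : DifferentiableAt ℝ f z) (hx : HasDerivAt (fun x => f (x, z.2)) fx z.1)
    (hr : HasDerivAt (fun r => f (z.1, r)) fr z.2) (y η : ℝ) :
    fderiv ℝ f z (y, η) = fx * y + fr * η := by
  have hx' := hf.hasFDerivAt.comp_hasDerivAt z.1
    ((hasDerivAt_id z.1).prodMk (hasDerivAt_const _ z.2))
  have hr' := hf.hasFDerivAt.comp_hasDerivAt z.2
    ((hasDerivAt_const _ z.1).prodMk (hasDerivAt_id z.2))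
  have hsplit : (y, η) = y • ((1 : ℝ), (0 : ℝ)) + η • ((0 : ℝ), (1 : ℝ)) := by simp
  rw [hsplit, map_add, map_smul, map_smul, ← hx.unique hx', ← hr.unique hr', smul_eq_mul,
    smul_eq_mul, mul_comm, mul_comm η]

theorem fderiv_attraction_apply (hr : 0 < r) (y η : ℝ) :
    fderiv ℝ (fun z : ℝ × ℝ => attraction z.1 z.2) (x, r) (y, η) =
      attractionX x r * y + attractionR x r * η :=
  fderiv_apply_eq_of_hasDerivAt
    ((contDiffOn_attraction.differentiableOn one_ne_zero).differentiableAt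
      (isOpen_setOf_snd_pos.mem_nhds hr))
    (hasDerivAt_attraction_fst hr) (hasDerivAt_attraction_snd hr) y η

theorem fderiv_attractionX_apply (hr : 0 < r) (y η : ℝ) :
    fderiv ℝ (fun z : ℝ × ℝ => attractionX z.1 z.2) (x, r) (y, η) =
      attractionXX x r * y + attractionXR x r * η :=
  fderiv_apply_eq_of_hasDerivAt
    ((contDiffOn_attractionX.differentiableOn one_ne_zero).differentiableAt
      (isOpen_setOf_snd_pos.mem_nhds hr))
    (hasDerivAt_attractionX_fst hr) (hasDerivAt_attractionX_snd hr) y η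

theorem abs_attractionX_le (hr : 0 < r) (x : ℝ) : |attractionX x r| ≤ 2 * (r ^ 3)⁻¹ := by
  have hpos := invDist_pos (x := x) hr
  have hsq := invDist_sq_mul (x := x) hr
  have hle : invDist x r ≤ r⁻¹ :=
    inv_anti₀ hr (le_sqrt_of_sq_le (le_add_of_nonneg_left (sq_nonneg x)))
  have hfactor : attractionX x r = invDist x r ^ 3 * (1 - 3 * (invDist x r ^ 2 * x ^ 2)) := by
    unfold attractionX
    ring
  have hx : 0 ≤ invDist x r ^ 2 * x ^ 2 := by positivity
  have hx' : invDist x r ^ 2 * x ^ 2 ≤ 1 :=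
    hsq ▸ mul_le_mul_of_nonneg_left (le_add_of_nonneg_right (sq_nonneg r)) (sq_nonneg _)
  rw [hfactor, abs_mul, abs_of_pos (by positivity), mul_comm, ← inv_pow]
  gcongr
  exact abs_le.2 ⟨by linarith, by linarith⟩

theorem lipschitzForce_attraction {ρ : ℝ → ℝ} (hρ : Continuous ρ) (hpos : ∀ t, 0 < ρ t) :
    LipschitzForce fun x t => attraction x (ρ t) where
  continuous := contDiffOn_attraction.continuousOn.comp_continuous
    (continuous_fst.prodMk (hρ.comp continuous_snd)) fun z => hpos z.2
  lipschitzWith := by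
    refine ⟨fun t => Real.toNNReal (2 * (ρ t ^ 3)⁻¹), ?_, fun t =>
      lipschitzWith_of_nnnorm_deriv_le
        (fun x => (hasDerivAt_attraction_fst (hpos t)).differentiableAt) fun x => ?_⟩
    · exact continuous_real_toNNReal.comp (continuous_const.mul
        ((hρ.pow 3).inv₀ fun t => (pow_pos (hpos t) 3).ne'))
    · rw [(hasDerivAt_attraction_fst (hpos t)).deriv]
      exact NNReal.coe_le_coe.1 ((abs_attractionX_le (hpos t) x).trans (le_coe_toNNReal _))

theorem lipschitzForce_force {e : ℝ} (he : |e| < 1) : LipschitzForce (force · · e) := by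
  simpa only [force_eq_attraction] using
    lipschitzForce_attraction (continuous_radius he) (radius_pos he)

theorem deriv_force {e : ℝ} (he : |e| < 1) (x t : ℝ) :
    deriv (force · t e) x = attractionX x (radius t e) := by
  simp only [force_eq_attraction]
  exact (hasDerivAt_attraction_fst (radius_pos he t)).deriv

theorem force_neg (x t e : ℝ) : force (-x) t e = -force x t e := by
  simp [force_eq_attraction, attraction_neg]

theorem force_zero (x t : ℝ) : force x t 0 = attraction x (1 / 2) := by
  rw [force_eq_attraction, radius_zero]

end Attraction

section HillTrace

variable {q q₁ : ℝ → ℝ} {x y z : ℝ → ℝ}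

theorem hillSolution_spec (hq : Continuous q) (a b : ℝ) :
    IsSolution (fun x t => q t * x) (hillSolution q a b) ∧ hillSolution q a b 0 = a ∧
      deriv (hillSolution q a b) 0 = b :=
  Classical.epsilon_spec ((lipschitzForce_linear hq).exists_isSolution a b)

theorem hillSolution_eq (hq : Continuous q) (hy : IsSolution (fun x t => q t * x) y) :
    hillSolution q (y 0) (deriv y 0) = y :=
  have h := hillSolution_spec hq (y 0) (deriv y 0)
  (lipschitzForce_linear hq).eq_of_isSolution h.1 hy h.2.1 h.2.2

theorem IsSolution.linear_combination (hy : IsSolution (fun x t => q t * x) y)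
    (hz : IsSolution (fun x t => q t * x) z) (a b : ℝ) :
    IsSolution (fun x t => q t * x) (fun t => a * y t + b * z t) ∧
      deriv (fun t => a * y t + b * z t) = fun t => a * deriv y t + b * deriv z t :=
  isSolution_of_hasDerivAt
    (fun t => ((hy.hasDerivAt t).const_mul a).add ((hz.hasDerivAt t).const_mul b))
    fun t => (((hy.2 t).const_mul a).add ((hz.2 t).const_mul b)).congr_deriv (by ring)

theorem IsSolution.eq_linear_combination (hq : Continuous q)
    (hx : IsSolution (fun x t => q t * x) x) (hy : IsSolution (fun x t => q t * x) y)
    (hz : IsSolution (fun x t => q t * x) z) {a b t₀ : ℝ} (h : x t₀ = a * y t₀ + b * z t₀)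
    (h' : deriv x t₀ = a * deriv y t₀ + b * deriv z t₀) :
    x = (fun t => a * y t + b * z t) ∧ deriv x = fun t => a * deriv y t + b * deriv z t := by
  obtain ⟨hsol, hderiv⟩ := hy.linear_combination hz a b
  have heq := (lipschitzForce_linear hq).eq_of_isSolution hx hsol h (by rw [h', hderiv])
  exact ⟨heq, heq ▸ hderiv⟩

theorem hillTrace_eq_of_wronskian_eq_one (hq : Continuous q)
    (hx : IsSolution (fun x t => q t * x) x) (hy : IsSolution (fun x t => q t * x) y)
    (hW : x 0 * deriv y 0 - deriv x 0 * y 0 = 1) (T : ℝ) :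
    hillTrace q T =
      x T * deriv y 0 - deriv x T * y 0 + (x 0 * deriv y T - deriv x 0 * y T) := by
  obtain ⟨h₁, h₁0, h₁0'⟩ := hillSolution_spec hq 1 0
  obtain ⟨h₂, h₂0, h₂0'⟩ := hillSolution_spec hq 0 1
  have hexpand {z : ℝ → ℝ} (hz : IsSolution (fun x t => q t * x) z) :=
    hz.eq_linear_combination hq h₁ h₂ (t₀ := 0) (a := z 0) (b := deriv z 0)
      (by simp [h₁0, h₂0]) (by simp [h₁0', h₂0'])
  have hxT := congrFun (hexpand hx).1 T
  have hxT' := congrFun (hexpand hx).2 T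
  have hyT := congrFun (hexpand hy).1 T
  have hyT' := congrFun (hexpand hy).2 T
  rw [hillTrace, hxT, hxT', hyT, hyT']
  linear_combination
    -(hillSolution q 1 0 T + deriv (hillSolution q 0 1) T) * hW

theorem wronskian_eq_integral (hq₁ : Continuous q₁) (hx : Continuous x)
    (hz : IsSolution (fun z t => q t * z + q₁ t * x t) z) (hz₀ : z 0 = 0) (hz₁ : deriv z 0 = 0)
    (hy : IsSolution (fun x t => q t * x) y) (T : ℝ) :
    z T * deriv y T - deriv z T * y T = ∫ t in (0)..T, q₁ t * x t * y t := by
  have hderiv (t : ℝ) :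
      HasDerivAt (fun t => z t * deriv y t - deriv z t * y t) (q₁ t * x t * y t) t :=
    (((hz.hasDerivAt t).mul (hy.2 t)).sub ((hz.2 t).mul (hy.hasDerivAt t))).congr_deriv (by ring)
  have hy' := hy.continuous
  rw [intervalIntegral.integral_eq_sub_of_hasDerivAt (fun t _ => hderiv t)
    ((by fun_prop : Continuous fun t => q₁ t * x t * y t).intervalIntegrable _ _), hz₀, hz₁]
  ring

theorem IsSolution.wronskian_eq (hy : IsSolution (fun x t => q t * x) y)
    (hz : IsSolution (fun x t => q t * x) z) (t s : ℝ) :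
    y t * deriv z t - deriv y t * z t = y s * deriv z s - deriv y s * z s := by
  have hderiv (t : ℝ) : HasDerivAt (fun t => y t * deriv z t - deriv y t * z t) 0 t :=
    (((hy.hasDerivAt t).mul (hz.2 t)).sub ((hy.2 t).mul (hz.hasDerivAt t))).congr_deriv (by ring)
  exact is_const_of_deriv_eq_zero (fun t => (hderiv t).differentiableAt)
    (fun t => (hderiv t).deriv) t s

variable {T : ℝ≥0} {Q : ℝ → ℝ → ℝ} {e₀ : ℝ}

theorem exists_hasDerivAt_hillSolution (hQ : ∀ᶠ e in 𝓝 e₀, Continuous (Q e))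
    (hq₁ : Continuous q₁) (hQ' : HasStrictDerivAt (fun e => path T (Q e)) (path T q₁) e₀)
    (hx : IsSolution (fun x t => Q e₀ t * x) x) :
    ∃ z, IsSolution (fun z t => Q e₀ t * z + q₁ t * x t) z ∧ z 0 = 0 ∧ deriv z 0 = 0 ∧
      HasDerivAt (fun e => hillSolution (Q e) (x 0) (deriv x 0) T) (z T) e₀ ∧
      HasDerivAt (fun e => deriv (hillSolution (Q e) (x 0) (deriv x 0)) T) (deriv z T) e₀ := by
  have hQ₀ := hQ.self_of_nhds
  have hspec := hQ.mono fun e he => hillSolution_spec he (x 0) (deriv x 0)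
  have hx₀ : hillSolution (Q e₀) (x 0) (deriv x 0) = x := hillSolution_eq hQ₀ hx
  obtain ⟨z, hz, hz₀, hz₁⟩ :=
    (lipschitzForce_affine hQ₀ (hq₁.mul hx.continuous)).exists_isSolution 0 0
  have hfderiv (u : ℝ × ℝ) (y η : ℝ) :
      fderiv ℝ (fun u : ℝ × ℝ => u.2 * u.1) u (y, η) = u.2 * y + u.1 * η :=
    fderiv_apply_eq_of_hasDerivAt (by fun_prop) (by simpa using (hasDerivAt_id u.1).const_mul u.2)
      (by simpa using (hasDerivAt_id u.2).mul_const u.1) y η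
  have h := hasStrictDerivAt_path_of_isSolution (T := T) (f := fun u => u.2 * u.1) isOpen_univ
    (by fun_prop) (fun _ => mem_univ _) hQ (hQ.mono fun e he => lipschitzForce_linear he)
    (x := fun e => hillSolution (Q e) (x 0) (deriv x 0)) (hspec.mono fun e he => he.1) hq₁ hQ'
    (w := z) (by simpa [hfderiv, hx₀, mul_comm (x _)] using hz)
    (by
      rw [hz₀]
      exact (hasStrictDerivAt_const e₀ (x 0)).congr_of_eventuallyEq
        (hspec.mono fun e he => he.2.1.symm))
    (by
      rw [hz₁]
      exact (hasStrictDerivAt_const e₀ (deriv x 0)).congr_of_eventuallyEq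
        (hspec.mono fun e he => he.2.2.symm))
  let tT : Icc (0 : ℝ) T := ⟨T, T.coe_nonneg, le_rfl⟩
  exact ⟨z, hz, hz₀, hz₁,
    (hasStrictDerivAt_eval_path (hspec.mono fun e he => he.1.continuous) hz.continuous h.1
      tT).hasDerivAt,
    (hasStrictDerivAt_eval_path (hspec.mono fun e he => he.1.continuous_deriv) hz.continuous_deriv
      h.2 tT).hasDerivAt⟩

/-- At a potential with the `T`-periodic solution `χ`, the second solution `y` being shifted by
`c χ` over the period, the Poincaré matrix is parabolic and only `∫ q₁ χ²` survives. -/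
theorem hasDerivAt_hillTrace (hQ : ∀ᶠ e in 𝓝 e₀, Continuous (Q e)) (hq₁ : Continuous q₁)
    (hQ' : HasStrictDerivAt (fun e => path T (Q e)) (path T q₁) e₀) {χ : ℝ → ℝ} {c : ℝ}
    (hχ : IsSolution (fun x t => Q e₀ t * x) χ) (hy : IsSolution (fun x t => Q e₀ t * x) y)
    (hW : χ 0 * deriv y 0 - deriv χ 0 * y 0 = 1) (hχT : χ T = χ 0) (hχT' : deriv χ T = deriv χ 0)
    (hyT : y T = y 0 + c * χ 0) (hyT' : deriv y T = deriv y 0 + c * deriv χ 0) :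
    HasDerivAt (fun e => hillTrace (Q e) T) (-c * ∫ t in (0)..T, q₁ t * χ t ^ 2) e₀ := by
  obtain ⟨w, hw, hw₀, hw₁, hwT, hwT'⟩ := exists_hasDerivAt_hillSolution hQ hq₁ hQ' hχ
  obtain ⟨z, hz, hz₀, hz₁, hzT, hzT'⟩ := exists_hasDerivAt_hillSolution hQ hq₁ hQ' hy
  have hwχ := wronskian_eq_integral hq₁ hχ.continuous hw hw₀ hw₁ hχ T
  have hwy := wronskian_eq_integral hq₁ hχ.continuous hw hw₀ hw₁ hy T
  have hzχ := wronskian_eq_integral hq₁ hy.continuous hz hz₀ hz₁ hχ T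
  have hsymm : ∫ t in (0)..(T : ℝ), q₁ t * χ t * y t = ∫ t in (0)..(T : ℝ), q₁ t * y t * χ t :=
    intervalIntegral.integral_congr fun t _ => mul_right_comm _ _ _
  have hsq : ∫ t in (0)..(T : ℝ), q₁ t * χ t ^ 2 = ∫ t in (0)..(T : ℝ), q₁ t * χ t * χ t :=
    intervalIntegral.integral_congr fun t _ => by ring
  have htrace := (((hwT.mul_const (deriv y 0)).sub (hwT'.mul_const (y 0))).add
    ((hzT'.const_mul (χ 0)).sub (hzT.const_mul (deriv χ 0))))
  refine (htrace.congr_deriv ?_).congr_of_eventuallyEq ?_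
  · rw [hsq, ← hwχ, hχT, hχT']
    rw [hχT, hχT', hyT, hyT'] at *
    linear_combination hwy - hzχ + hsymm
  · filter_upwards [hQ] with e hQe
    obtain ⟨hsχ, hsχ₀, hsχ₁⟩ := hillSolution_spec hQe (χ 0) (deriv χ 0)
    obtain ⟨hsy, hsy₀, hsy₁⟩ := hillSolution_spec hQe (y 0) (deriv y 0)
    rw [hillTrace_eq_of_wronskian_eq_one hQe hsχ hsy (by rw [hsχ₀, hsχ₁, hsy₀, hsy₁, hW]) T,
      hsχ₀, hsχ₁, hsy₀, hsy₁]
    rfl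

end HillTrace

section Linearization

variable {x y w : ℝ → ℝ}

/-- `x` is a solution of the circular Sitnikov problem, that is, of the problem with `e = 0`. -/
def IsCircularSolution (x : ℝ → ℝ) : Prop :=
  IsSolution (fun x _ => attraction x (1 / 2)) x

theorem isSolution_force_zero_iff : IsSolution (force · · 0) x ↔ IsCircularSolution x := by
  simp only [force_zero, IsCircularSolution]

theorem IsCircularSolution.isSolution_deriv (hx : IsCircularSolution x) :
    IsSolution (fun y t => attractionX (x t) (1 / 2) * y) (deriv x) ∧
      deriv (deriv x) = fun t => -attraction (x t) (1 / 2) :=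
  isSolution_of_hasDerivAt hx.2 fun t =>
    ((hasDerivAt_attraction_fst one_half_pos).comp t (hx.hasDerivAt t)).neg

/-- The coefficient of `cos t` in the derivative of the force with respect to the eccentricity at
`e = 0`, where `∂r/∂e = -cos t / 2`. -/
def tidal (x : ℝ) : ℝ :=
  -(1 / 2) * attractionR x (1 / 2)

theorem continuous_invDist {r : ℝ} (hr : 0 < r) : Continuous (invDist · r) :=
  continuous_iff_continuousAt.2 fun _ => (hasDerivAt_invDist_fst hr).continuousAt

theorem continuous_tidal : Continuous tidal := by
  have := continuous_invDist one_half_pos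
  unfold tidal attractionR
  fun_prop

theorem continuous_attractionX {ρ : ℝ → ℝ} (hx : Continuous x) (hρ : Continuous ρ)
    (hpos : ∀ t, 0 < ρ t) : Continuous fun t => attractionX (x t) (ρ t) :=
  contDiffOn_attractionX.continuousOn.comp_continuous (hx.prodMk hρ) hpos

theorem IsCircularSolution.continuous_attractionX (hx : IsCircularSolution x) :
    Continuous fun t => attractionX (x t) (1 / 2) :=
  Sitnikov.continuous_attractionX hx.continuous continuous_const fun _ => one_half_pos

/-- The derivative at `e = 0` of the potential `∂F/∂x(x(t,e),t,e)` along a family of solutions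
with circular solution `x` and first variation `w` at `e = 0`. -/
def potentialVariation (x w : ℝ → ℝ) (t : ℝ) : ℝ :=
  attractionXX (x t) (1 / 2) * w t + attractionXR (x t) (1 / 2) * (-(1 / 2) * cos t)

theorem continuous_potentialVariation (hx : Continuous x) (hw : Continuous w) :
    Continuous (potentialVariation x w) := by
  have := (continuous_invDist one_half_pos).comp hx
  unfold Function.comp at this
  unfold potentialVariation attractionXX attractionXR
  fun_prop

theorem IsCircularSolution.integral_potentialVariation_mul_sq {T : ℝ} (hx : IsCircularSolution x)
    (hw : IsSolution (fun y t => attractionX (x t) (1 / 2) * y + tidal (x t) * cos t) w)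
    (hxT : x T = x 0) (hxT' : deriv x T = deriv x 0) (hwT : w T = w 0)
    (hwT' : deriv w T = deriv w 0) (hT : cos T = 1) :
    ∫ t in (0)..T, potentialVariation x w t * deriv x t ^ 2 =
      ∫ t in (0)..T, tidal (x t) * deriv x t * sin t := by
  obtain ⟨hx', hx''⟩ := hx.isSolution_deriv
  have hforce (t : ℝ) : HasDerivAt (fun t => -attraction (x t) (1 / 2))
      (-(attractionX (x t) (1 / 2) * deriv x t)) t := hx'' ▸ hx'.2 t
  have hpotential (t : ℝ) := (hasDerivAt_attractionX_fst one_half_pos).comp t (hx.hasDerivAt t)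
  have htidal (t : ℝ) := ((hasDerivAt_attractionR_fst one_half_pos).comp t
    (hx.hasDerivAt t)).const_mul (-(1 / 2))
  -- `Φ = w' x'' - w'' x'`
  let Φ (t : ℝ) : ℝ := deriv w t * -attraction (x t) (1 / 2) +
    (attractionX (x t) (1 / 2) * w t + tidal (x t) * cos t) * deriv x t
  have hΦ (t : ℝ) : HasDerivAt Φ (potentialVariation x w t * deriv x t ^ 2 -
      tidal (x t) * deriv x t * sin t) t :=
    (((hw.2 t).mul (hforce t)).add ((((hpotential t).mul (hw.hasDerivAt t)).add
      ((htidal t).mul (hasDerivAt_cos t))).mul (hx.2 t))).congr_deriv (by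
        simp only [potentialVariation, tidal, Function.comp_apply, Pi.add_apply, Pi.mul_apply]
        ring)
  have hΦT : Φ T = Φ 0 := by simp only [Φ, hxT, hxT', hwT, hwT', hT, cos_zero]
  have hxc := hx.continuous
  have hxc' := hx.continuous_deriv
  have hleft : Continuous fun t => potentialVariation x w t * deriv x t ^ 2 :=
    (continuous_potentialVariation hxc hw.continuous).mul (hxc'.pow 2)
  have hright : Continuous fun t => tidal (x t) * deriv x t * sin t :=
    ((continuous_tidal.comp hxc).mul hxc').mul continuous_sin
  have hint := intervalIntegral.integral_eq_sub_of_hasDerivAt (fun t _ => hΦ t)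
    ((hleft.sub hright).intervalIntegrable 0 T)
  rw [intervalIntegral.integral_sub (hleft.intervalIntegrable _ _)
    (hright.intervalIntegrable _ _), hΦT, sub_self] at hint
  exact sub_eq_zero.1 hint

variable {x : ℝ → ℝ → ℝ} {T : ℝ≥0}

theorem hasStrictDerivAt_path_of_isSolution_force
    (hx : ∀ᶠ e in 𝓝 0, IsSolution (force · · e) (x e))
    (hw : IsSolution (fun y t => attractionX (x 0 t) (1 / 2) * y + tidal (x 0 t) * cos t) w)
    (hw₀ : HasStrictDerivAt (fun e => x e 0) (w 0) 0)
    (hw₁ : HasStrictDerivAt (fun e => deriv (x e) 0) (deriv w 0) 0) :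
    HasStrictDerivAt (fun e => path T (x e)) (path T w) 0 ∧
      HasStrictDerivAt (fun e => path T (deriv (x e))) (path T (deriv w)) 0 := by
  refine hasStrictDerivAt_path_of_isSolution (ρ := fun e t => radius t e) isOpen_setOf_snd_pos
    contDiffOn_attraction (fun t => radius_pos (by simp) t)
    (eventually_abs_lt_one.mono fun e he => continuous_radius he)
    (eventually_abs_lt_one.mono fun e he => by
      simpa only [force_eq_attraction] using lipschitzForce_force he)
    (by simpa only [force_eq_attraction] using hx) (by fun_prop) hasStrictDerivAt_path_radius
    (hw.congr_force fun t => ?_) hw₀ hw₁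
  rw [radius_zero, fderiv_attraction_apply one_half_pos, tidal]
  ring

theorem hasStrictDerivAt_path_potential (hx : ∀ᶠ e in 𝓝 0, Continuous (x e)) (hw : Continuous w)
    (hxw : HasStrictDerivAt (fun e => path T (x e)) (path T w) 0) :
    HasStrictDerivAt (fun e => path T fun t => attractionX (x e t) (radius t e))
      (path T (potentialVariation (x 0) w)) 0 := by
  have h := hasStrictDerivAt_path_comp (ρ := fun e t => radius t e) isOpen_setOf_snd_pos
    contDiffOn_attractionX (fun t => radius_pos (by simp) t) hx
    (eventually_abs_lt_one.mono fun e he => continuous_radius he)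
    (by
      filter_upwards [hx, eventually_abs_lt_one] with e hx he
      exact continuous_attractionX hx (continuous_radius he) (radius_pos he)) hw (by fun_prop) hxw
    hasStrictDerivAt_path_radius
  simp only [radius_zero, fderiv_attractionX_apply one_half_pos] at h
  exact h

theorem hasDerivAt_linearizedTrace {a b c : ℝ} {m : ℕ}
    (hx : ∀ᶠ e in 𝓝 0, IsSolution (force · · e) (x e))
    (ha : HasStrictDerivAt (fun e => x e 0) a 0)
    (hb : HasStrictDerivAt (fun e => deriv (x e) 0) b 0)
    (hper : ∀ᶠ e in 𝓝 0, x e (2 * m * π) = x e 0 ∧ deriv (x e) (2 * m * π) = deriv (x e) 0)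
    (hy : IsSolution (fun y t => attractionX (x 0 t) (1 / 2) * y) y)
    (hW : deriv (x 0) 0 * deriv y 0 - deriv (deriv (x 0)) 0 * y 0 = 1)
    (hyT : y (2 * m * π) = y 0 + c * deriv (x 0) 0)
    (hyT' : deriv y (2 * m * π) = deriv y 0 + c * deriv (deriv (x 0)) 0) :
    HasDerivAt (linearizedTrace m fun t e => x e t)
      (-c * ∫ t in (0)..2 * m * π, tidal (x 0 t) * deriv (x 0) t * sin t) 0 := by
  let T : ℝ≥0 := 2 * m * NNReal.pi
  have hT : (T : ℝ) = 2 * m * π := by simp [T]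
  rw [← hT] at hyT hyT'
  simp only [← hT] at hper
  have hx₀ : IsCircularSolution (x 0) := isSolution_force_zero_iff.1 hx.self_of_nhds
  obtain ⟨hx₀', hx₀''⟩ := hx₀.isSolution_deriv
  have hxc := hx.mono fun e he => he.continuous
  obtain ⟨w, hw, rfl, rfl⟩ := (lipschitzForce_affine hx₀.continuous_attractionX
    ((continuous_tidal.comp hx₀.continuous).mul continuous_cos)).exists_isSolution a b
  obtain ⟨hxw, hxw'⟩ := hasStrictDerivAt_path_of_isSolution_force (T := T) hx hw ha hb
  let tT : Icc (0 : ℝ) T := ⟨T, T.coe_nonneg, le_rfl⟩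
  have hwT : w T = w 0 :=
    (hasStrictDerivAt_eval_path hxc hw.continuous hxw tT).hasDerivAt.unique
      (ha.hasDerivAt.congr_of_eventuallyEq (hper.mono fun e he => he.1))
  have hwT' : deriv w T = deriv w 0 :=
    (hasStrictDerivAt_eval_path (hx.mono fun e he => he.continuous_deriv) hw.continuous_deriv
      hxw' tT).hasDerivAt.unique
      (hb.hasDerivAt.congr_of_eventuallyEq (hper.mono fun e he => he.2))
  have hcos : cos T = 1 := by
    rw [hT, show 2 * m * π = m * (2 * π) by ring, cos_nat_mul_two_pi]
  rw [← hT, ← hx₀.integral_potentialVariation_mul_sq hw hper.self_of_nhds.1 hper.self_of_nhds.2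
    hwT hwT' hcos]
  have htrace := hasDerivAt_hillTrace (T := T) (Q := fun e t => attractionX (x e t) (radius t e))
    (c := c) (χ := deriv (x 0)) (y := y) ?_
    (continuous_potentialVariation hx₀.continuous hw.continuous)
    (hasStrictDerivAt_path_potential hxc hw.continuous hxw)
    (by simpa only [radius_zero] using hx₀') (by simpa only [radius_zero] using hy) hW
    hper.self_of_nhds.2 (by simp only [hx₀'', hper.self_of_nhds.1]) hyT hyT'
  · refine htrace.congr_of_eventuallyEq (eventually_abs_lt_one.mono fun e he => ?_)
    simp only [linearizedTrace, deriv_force he, hT]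
  · filter_upwards [hxc, eventually_abs_lt_one] with e hx he
    exact continuous_attractionX hx (continuous_radius he) (radius_pos he)

end Linearization

section Flow

variable {e a b : ℝ} {x : ℝ → ℝ} {T : ℝ≥0}

/-- The solution of the elliptic Sitnikov problem of eccentricity `e` with initial position `a` and
initial velocity `b` (for `|e| < 1`). -/
def flow (e a b : ℝ) : ℝ → ℝ :=
  Classical.epsilon fun x => IsSolution (force · · e) x ∧ x 0 = a ∧ deriv x 0 = b

theorem flow_spec (he : |e| < 1) (a b : ℝ) :
    IsSolution (force · · e) (flow e a b) ∧ flow e a b 0 = a ∧ deriv (flow e a b) 0 = b :=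
  Classical.epsilon_spec ((lipschitzForce_force he).exists_isSolution a b)

theorem flow_eq (he : |e| < 1) (hx : IsSolution (force · · e) x) :
    flow e (x 0) (deriv x 0) = x :=
  have h := flow_spec he (x 0) (deriv x 0)
  (lipschitzForce_force he).eq_of_isSolution h.1 hx h.2.1 h.2.2

theorem eventually_flow_spec (p₀ : ℝ × ℝ) :
    ∀ᶠ p : ℝ × ℝ × ℝ in 𝓝 (0, p₀), IsSolution (force · · p.1) (flow p.1 p.2.1 p.2.2) ∧
      flow p.1 p.2.1 p.2.2 0 = p.2.1 ∧ deriv (flow p.1 p.2.1 p.2.2) 0 = p.2.2 :=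
  (continuous_fst.tendsto' (0, p₀) 0 rfl).eventually
    (eventually_abs_lt_one.mono fun _ he => flow_spec he) |>.mono fun p h => h p.2.1 p.2.2

theorem exists_hasStrictFDerivAt_flow (p₀ : ℝ × ℝ) :
    ∃ ξ ξ' : ℝ × ℝ × ℝ →L[ℝ] C(Icc (0 : ℝ) T, ℝ),
      HasStrictFDerivAt (fun p => path T (flow p.1 p.2.1 p.2.2)) ξ (0, p₀) ∧
      HasStrictFDerivAt (fun p => path T (deriv (flow p.1 p.2.1 p.2.2))) ξ' (0, p₀) ∧
      ∀ w, IsSolution (fun y t => attractionX (flow 0 p₀.1 p₀.2 t) (1 / 2) * y) w →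
        ξ (0, w 0, deriv w 0) = path T w ∧ ξ' (0, w 0, deriv w 0) = path T (deriv w) := by
  have hlt : ∀ᶠ p : ℝ × ℝ × ℝ in 𝓝 (0, p₀), |p.1| < 1 :=
    (continuous_fst.tendsto' (0, p₀) 0 rfl).eventually eventually_abs_lt_one
  have hspec := eventually_flow_spec p₀
  have hρ := (hasStrictDerivAt_path_radius (T := T)).hasStrictFDerivAt.comp ((0 : ℝ), p₀)
    (hasStrictFDerivAt_fst (𝕜 := ℝ) (p := ((0 : ℝ), p₀)))
  have ha := (hasStrictFDerivAt_snd (𝕜 := ℝ) (p := ((0 : ℝ), p₀))).fst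
  have hb := (hasStrictFDerivAt_snd (𝕜 := ℝ) (p := ((0 : ℝ), p₀))).snd
  obtain ⟨ξ, ξ', hξ, hξ', h⟩ := exists_hasStrictFDerivAt_path (T := T)
    (x := fun p : ℝ × ℝ × ℝ => flow p.1 p.2.1 p.2.2) (ρ := fun p t => radius t p.1)
    isOpen_setOf_snd_pos contDiffOn_attraction (fun t => radius_pos (by simp) t)
    (hlt.mono fun p hp => continuous_radius hp)
    (hlt.mono fun p hp => by simpa only [force_eq_attraction] using lipschitzForce_force hp)
    (hspec.mono fun p hp => by simpa only [force_eq_attraction] using hp.1) hρ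
    (ha.congr_of_eventuallyEq (hspec.mono fun p hp => hp.2.1.symm))
    (hb.congr_of_eventuallyEq (hspec.mono fun p hp => hp.2.2.symm))
  refine ⟨ξ, ξ', hξ, hξ', fun w hw => h _ (fun _ => 0) w continuous_const ?_ ?_ rfl rfl⟩
  · ext t
    simp [path_apply continuous_const]
  · simpa only [radius_zero, fderiv_attraction_apply one_half_pos, mul_zero, add_zero] using hw

theorem continuous_path_flow_zero :
    Continuous fun p : ℝ × ℝ => path T (flow 0 p.1 p.2) :=
  continuous_iff_continuousAt.2 fun p₀ =>
    have ⟨_, _, h, _⟩ := exists_hasStrictFDerivAt_flow p₀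
    h.continuousAt.comp (f := fun p : ℝ × ℝ => ((0 : ℝ), p)) (by fun_prop)

end Flow

section Branch

variable {α β v : ℝ} {T : ℝ≥0} {x w : ℝ → ℝ}

/-- The bifurcation function, at eccentricity `z.1`, of the solution starting from `z.2 • (α, β)`.
It is the position at time `T` for the odd solutions, `(α, β) = (0, 1)`, and the velocity at time
`T` for the even ones, `(α, β) = (1, 0)`. -/
def bifurcation (T α β : ℝ) (z : ℝ × ℝ) : ℝ :=
  β * flow z.1 (z.2 * α) (z.2 * β) T + α * deriv (flow z.1 (z.2 * α) (z.2 * β)) T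

theorem exists_hasStrictFDerivAt_bifurcation (v : ℝ)
    (hw : IsSolution (fun y t => attractionX (flow 0 (v * α) (v * β) t) (1 / 2) * y) w)
    (hw₀ : w 0 = α) (hw₁ : deriv w 0 = β) :
    ∃ Φ' : ℝ × ℝ →L[ℝ] ℝ, HasStrictFDerivAt (bifurcation T α β) Φ' (0, v) ∧
      Φ' (0, 1) = β * w T + α * deriv w T := by
  obtain ⟨ξ, ξ', hξ, hξ', h⟩ := exists_hasStrictFDerivAt_flow (T := T) (v * α, v * β)
  obtain ⟨hξw, hξ'w⟩ := h w hw
  have hspec := eventually_flow_spec (v * α, v * β)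
  let L : ℝ × ℝ →L[ℝ] ℝ × ℝ × ℝ := (ContinuousLinearMap.fst ℝ ℝ ℝ).prod
    ((α • ContinuousLinearMap.snd ℝ ℝ ℝ).prod (β • ContinuousLinearMap.snd ℝ ℝ ℝ))
  have hL (z : ℝ × ℝ) : L z = (z.1, z.2 * α, z.2 * β) := by simp [L, mul_comm]
  let tT : Icc (0 : ℝ) T := ⟨T, T.coe_nonneg, le_rfl⟩
  have hflow := hasStrictFDerivAt_eval_path (hspec.mono fun p hp => hp.1.continuous) hξ tT
  have hflow' := hasStrictFDerivAt_eval_path (hspec.mono fun p hp => hp.1.continuous_deriv) hξ' tT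
  rw [← hL (0, v)] at hflow hflow'
  have hΦ := ((hflow.comp (0, v) L.hasStrictFDerivAt).const_mul β).add
    ((hflow'.comp (0, v) L.hasStrictFDerivAt).const_mul α)
  simp only [hL] at hΦ
  refine ⟨_, hΦ, ?_⟩
  simp only [add_apply, smul_apply, ContinuousLinearMap.comp_apply, hL, one_mul, ← hw₀, ← hw₁,
    hξw, hξ'w, ContinuousMap.evalCLM_apply, path_apply hw.continuous,
    path_apply hw.continuous_deriv, smul_eq_mul]
  rfl

theorem exists_branch (hzero : bifurcation T α β (0, v) = 0)
    (hw : IsSolution (fun y t => attractionX (flow 0 (v * α) (v * β) t) (1 / 2) * y) w)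
    (hw₀ : w 0 = α) (hw₁ : deriv w 0 = β) (hne : β * w T + α * deriv w T ≠ 0) :
    ∃ (V : ℝ → ℝ) (V' : ℝ), HasStrictDerivAt V V' 0 ∧ V 0 = v ∧
      (∀ᶠ e in 𝓝 0, bifurcation T α β (e, V e) = 0) ∧
      ∀ᶠ z in 𝓝 (0, v), bifurcation T α β z = 0 → V z.1 = z.2 := by
  obtain ⟨Φ', hΦ, hΦ'⟩ := exists_hasStrictFDerivAt_bifurcation v hw hw₀ hw₁ (T := T)
  rw [← hΦ'] at hne
  obtain ⟨V, V', hV, hV_zero, hV_unique, -⟩ := exists_implicitFunction hΦ hzero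
    (L := .toSpanSingleton ℝ (Φ' (0, 1)))
    ⟨ContinuousLinearEquiv.unitsEquivAut ℝ (Units.mk0 _ hne), by ext; simp⟩
    fun y => by
      rw [ContinuousLinearMap.toSpanSingleton_apply, ← map_smul]
      simp
  exact ⟨V, V' 1, hV.hasStrictDerivAt, hV_unique.self_of_nhds hzero, hV_zero, hV_unique⟩

end Branch

section FirstZero

variable {f : ℝ → ℝ} {c s : ℝ}

theorem eventually_pos_right_of_deriv_pos (hc : f c = 0) (h : 0 < deriv f c) :
    ∀ᶠ t in 𝓝[>] c, 0 < f t := by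
  filter_upwards [nhdsWithin_le_nhds (eventually_nhdsWithin_sign_eq_of_deriv_pos h hc),
    self_mem_nhdsWithin] with t ht (hct : c < t)
  rwa [sign_pos (sub_pos.2 hct), sign_eq_one_iff] at ht

theorem deriv_nonpos_of_eventually_pos_left (hc : f c = 0) (h : ∀ᶠ t in 𝓝[<] c, 0 < f t) :
    deriv f c ≤ 0 := by
  by_contra! hlt
  have hsign := (eventually_nhdsWithin_sign_eq_of_deriv_pos hlt hc).filter_mono
    (nhdsWithin_le_nhds (s := Iio c))
  obtain ⟨t, ⟨ht, hsign⟩, htc⟩ := ((h.and hsign).and eventually_mem_nhdsWithin).exists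
  rw [sign_pos ht, sign_neg (sub_neg.2 htc)] at hsign
  exact absurd hsign (by decide)

theorem exists_first_zero (hf : Continuous f) (hpos : ∀ᶠ t in 𝓝[>] 0, 0 < f t) (hs : 0 < s)
    (hfs : f s ≤ 0) : ∃ c ∈ Ioc 0 s, f c = 0 ∧ ∀ t ∈ Ioo 0 c, 0 < f t := by
  obtain ⟨δ, hδ, hδ_pos⟩ := mem_nhdsGT_iff_exists_Ioo_subset.1 hpos
  have hδ : 0 < δ := hδ
  have hδs : δ ≤ s := not_lt.1 fun h => hfs.not_gt (hδ_pos ⟨hs, h⟩)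
  have hcompact : IsCompact (Icc (δ / 2) s ∩ f ⁻¹' Iic 0) :=
    isCompact_Icc.inter_right (isClosed_Iic.preimage hf)
  obtain ⟨c, ⟨⟨hδc, hcs⟩, hfc⟩, hmin⟩ :=
    hcompact.exists_isLeast ⟨s, ⟨by linarith, le_rfl⟩, hfs⟩
  have hc : 0 < c := by linarith
  have hc_pos : ∀ t ∈ Ioo 0 c, 0 < f t := fun t ht => by
    by_contra! hft
    rcases lt_or_ge t δ with htδ | hδt
    · exact hft.not_gt (hδ_pos ⟨ht.1, htδ⟩)
    · exact (hmin ⟨⟨by linarith, ht.2.le.trans hcs⟩, hft⟩).not_gt ht.2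
  refine ⟨c, ⟨hc, hcs⟩, hfc.antisymm ?_, hc_pos⟩
  refine ge_of_tendsto (hf.continuousAt.mono_left (nhdsWithin_le_nhds (s := Iio c))) ?_
  filter_upwards [Ioo_mem_nhdsLT hc] with t ht using (hc_pos t ht).le

theorem pos_of_hasDerivAt_pos {f' : ℝ → ℝ} (hf : ∀ t, HasDerivAt f (f' t) t) (h₀ : f 0 = 0)
    (hs : 0 < s) (hpos : ∀ t ∈ Ioo 0 s, 0 < f' t) : 0 < f s := by
  have hmono := strictMonoOn_of_deriv_pos (convex_Icc 0 s)
    (HasDerivAt.continuousOn fun t _ => hf t) fun t ht => by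
    rw [interior_Icc] at ht
    exact (hf t).deriv ▸ hpos t ht
  exact h₀ ▸ hmono (left_mem_Icc.2 hs.le) (right_mem_Icc.2 hs.le) hs

end FirstZero

section Circular

variable {x : ℝ → ℝ} {c s T : ℝ}

theorem IsCircularSolution.eq {y : ℝ → ℝ} (hx : IsCircularSolution x) (hy : IsCircularSolution y)
    (h : x c = y c) (h' : deriv x c = deriv y c) : x = y :=
  (lipschitzForce_attraction continuous_const fun _ => one_half_pos).eq_of_isSolution hx hy h h'

theorem IsCircularSolution.comp_add_const (hx : IsCircularSolution x) (c : ℝ) :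
    IsCircularSolution fun t => x (t + c) :=
  IsSolution.comp_add_const hx c

theorem IsCircularSolution.comp_neg (hx : IsCircularSolution x) :
    IsCircularSolution fun t => x (-t) :=
  IsSolution.comp_neg hx

theorem IsCircularSolution.neg (hx : IsCircularSolution x) : IsCircularSolution fun t => -x t := by
  simpa only [IsCircularSolution, attraction_neg, neg_neg] using IsSolution.neg hx

theorem IsCircularSolution.odd (hx : IsCircularSolution x) (h : x 0 = 0) : Function.Odd x :=
  fun t => by
    have := congrFun (hx.eq hx.comp_neg.neg (c := 0) (by simp [h]) (by simp [deriv_comp_neg])) t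
    linarith

theorem IsCircularSolution.even (hx : IsCircularSolution x) (h : deriv x 0 = 0) :
    Function.Even x :=
  fun t => (congrFun (hx.eq hx.comp_neg (c := 0) (by simp) (by simp [h, deriv_comp_neg])) t).symm

theorem IsCircularSolution.eq_zero (hx : IsCircularSolution x) (h : x c = 0)
    (h' : deriv x c = 0) : x = 0 := by
  have hzero : IsCircularSolution 0 :=
    (isSolution_of_hasDerivAt (v := 0) (fun t => hasDerivAt_const t 0)
      fun t => (hasDerivAt_const t 0).congr_deriv (by simp [attraction])).1
  exact hx.eq hzero h (by simpa using h')

theorem IsCircularSolution.energy (hx : IsCircularSolution x) (t : ℝ) :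
    deriv x t ^ 2 - 2 * invDist (x t) (1 / 2) = deriv x 0 ^ 2 - 2 * invDist (x 0) (1 / 2) := by
  have hderiv (t : ℝ) : HasDerivAt (fun t => deriv x t ^ 2 - 2 * invDist (x t) (1 / 2)) 0 t :=
    (((hx.2 t).fun_pow 2).sub (((hasDerivAt_invDist_fst one_half_pos).comp t
      (hx.hasDerivAt t)).const_mul 2)).congr_deriv (by simp only [attraction]; push_cast; ring)
  exact is_const_of_deriv_eq_zero (fun t => (hderiv t).differentiableAt)
    (fun t => (hderiv t).deriv) t 0

theorem IsCircularSolution.hasDerivAt_wronskian {y : ℝ → ℝ} (hx : IsCircularSolution x)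
    (hy : IsCircularSolution y) (t : ℝ) :
    HasDerivAt (fun t => deriv x t * y t - x t * deriv y t)
      (x t * y t * (invDist (y t) (1 / 2) ^ 3 - invDist (x t) (1 / 2) ^ 3)) t :=
  (((hx.2 t).mul (hy.hasDerivAt t)).sub ((hx.hasDerivAt t).mul (hy.2 t))).congr_deriv
    (by simp only [attraction]; ring)

/-- `x` is an odd solution of the circular problem with positive initial velocity and first
positive zero `s`. -/
structure IsArch (x : ℝ → ℝ) (s : ℝ) : Prop where
  circular : IsCircularSolution x
  zero : x 0 = 0
  velocity_pos : 0 < deriv x 0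
  length_pos : 0 < s
  right_zero : x s = 0
  pos : ∀ t ∈ Ioo 0 s, 0 < x t

namespace IsArch

variable {y : ℝ → ℝ}

theorem deriv_right (h : IsArch x s) : deriv x s = -deriv x 0 := by
  have henergy := h.circular.energy s
  rw [h.right_zero, h.zero] at henergy
  have hle := deriv_nonpos_of_eventually_pos_left h.right_zero <|
    Filter.mem_of_superset (Ioo_mem_nhdsLT h.length_pos) h.pos
  rcases sq_eq_sq_iff_eq_or_eq_neg.1 (by linarith : deriv x s ^ 2 = deriv x 0 ^ 2) with heq | heq
  · linarith [h.velocity_pos]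
  · exact heq

theorem antiperiodic (h : IsArch x s) : Antiperiodic x s := fun t =>
  congrFun ((h.circular.comp_add_const s).eq h.circular.neg (c := 0)
    (by simp [h.zero, h.right_zero]) (by simp [deriv_comp_add_const, h.deriv_right])) t

theorem isMinimalPeriod (h : IsArch x s) : IsMinimalPeriod x (2 * s) := by
  have hs := h.length_pos
  refine ⟨⟨by linarith, h.antiperiodic.periodic_two_mul⟩, fun S ⟨hS, hper⟩ => ?_⟩
  by_contra! hlt
  have hxS : x S = 0 := by rw [← zero_add S, hper 0, h.zero]
  have hxS' : deriv x S = deriv x 0 := by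
    simpa [deriv_comp_add_const] using congrArg (deriv · 0) (funext hper)
  rcases lt_trichotomy S s with hSs | rfl | hsS
  · exact (h.pos S ⟨hS, hSs⟩).ne' hxS
  · linarith [h.deriv_right, h.velocity_pos]
  · have hpos := h.pos (S - s) ⟨by linarith, by linarith⟩
    have hanti := h.antiperiodic (S - s)
    rw [sub_add_cancel, hxS] at hanti
    linarith

theorem velocity_le (hx : IsArch x s) (hy : IsArch y s) : deriv x 0 ≤ deriv y 0 := by
  by_contra! hlt
  have hderiv (t : ℝ) : deriv (fun t => x t - y t) t = deriv x t - deriv y t :=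
    ((hx.circular.hasDerivAt t).sub (hy.circular.hasDerivAt t)).deriv
  obtain ⟨c, hc, hxyc, hxy⟩ := exists_first_zero (f := fun t => x t - y t)
    (hx.circular.continuous.sub hy.circular.continuous)
    (eventually_pos_right_of_deriv_pos (by simp [hx.zero, hy.zero]) (by rw [hderiv]; linarith))
    hx.length_pos (by simp [hx.right_zero, hy.right_zero])
  have hW : 0 < deriv x c * y c - x c * deriv y c :=
    pos_of_hasDerivAt_pos (f := fun t => deriv x t * y t - x t * deriv y t)
      (hx.circular.hasDerivAt_wronskian hy.circular)
      (by simp [hx.zero, hy.zero]) hc.1 fun t ht => by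
        have hxt := hx.pos t ⟨ht.1, ht.2.trans_le hc.2⟩
        have hyt := hy.pos t ⟨ht.1, ht.2.trans_le hc.2⟩
        have hlt := invDist_lt one_half_pos hyt.le (sub_pos.1 (hxy t ht))
        have := sub_pos.2 (pow_lt_pow_left₀ hlt (invDist_pos one_half_pos).le three_ne_zero)
        positivity
  have hle := deriv_nonpos_of_eventually_pos_left (f := fun t => x t - y t) hxyc
    (Filter.mem_of_superset (Ioo_mem_nhdsLT hc.1) hxy)
  have hyc : 0 ≤ y c := hc.2.lt_or_eq.elim (fun h => (hy.pos c ⟨hc.1, h⟩).le)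
    fun h => h ▸ hy.right_zero.ge
  rw [sub_eq_zero.1 hxyc] at hW
  rw [hderiv] at hle
  nlinarith

protected theorem eq (hx : IsArch x s) (hy : IsArch y s) : x = y :=
  hx.circular.eq hy.circular (hx.zero.trans hy.zero.symm)
    ((hx.velocity_le hy).antisymm (hy.velocity_le hx))

end IsArch

theorem IsMinimalPeriod.comp_add_const (h : IsMinimalPeriod x T) (c : ℝ) :
    IsMinimalPeriod (fun t => x (t + c)) T := by
  have hiff (S : ℝ) : Periodic (fun t => x (t + c)) S ↔ Periodic x S :=
    ⟨fun h t => by simpa [add_right_comm] using h (t - c), fun h => h.add_const c⟩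
  simpa only [IsMinimalPeriod, hiff] using h

theorem IsCircularSolution.isArch_of_isMinimalPeriod (hx : IsCircularSolution x)
    (h₀ : x 0 = 0) (h₁ : 0 < deriv x 0) (hT : IsMinimalPeriod x T) : IsArch x (T / 2) := by
  obtain ⟨c, hc, hxc, hpos⟩ := exists_first_zero hx.continuous
    (eventually_pos_right_of_deriv_pos h₀ h₁) hT.1.1 (hT.1.2.eq.trans h₀).le
  have harch : IsArch x c := ⟨hx, h₀, h₁, hc.1, hxc, hpos⟩
  rwa [hT.unique harch.isMinimalPeriod, mul_div_cancel_left₀ _ two_ne_zero]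

theorem IsCircularSolution.isArch_of_even (hx : IsCircularSolution x) (h₀ : 0 < x 0)
    (h₁ : deriv x 0 = 0) (hc : 0 < c) (hxc : x c = 0) (hpos : ∀ t ∈ Ioo 0 c, 0 < x t) :
    IsArch (fun t => x (t - c)) (2 * c) where
  circular := hx.comp_add_const (-c)
  zero := by rw [zero_sub, hx.even h₁, hxc]
  velocity_pos := by
    have hodd : deriv x (-c) = -deriv x c := by
      rw [← neg_eq_iff_eq_neg, ← deriv_comp_neg, funext (hx.even h₁)]
    have hne : deriv x c ≠ 0 := fun h => by simp [hx.eq_zero hxc h] at h₀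
    have hle := deriv_nonpos_of_eventually_pos_left hxc
      (Filter.mem_of_superset (Ioo_mem_nhdsLT hc) hpos)
    rw [deriv_comp_sub_const, zero_sub, hodd]
    exact neg_pos.2 (hle.lt_of_ne hne)
  length_pos := by positivity
  right_zero := by rw [two_mul, add_sub_cancel_right, hxc]
  pos t ht := by
    have habs : x |t - c| = x (t - c) := by
      rcases abs_choice (t - c) with h | h <;> simp only [h, hx.even h₁ (t - c)]
    rw [← habs]
    rcases (abs_nonneg (t - c)).eq_or_lt' with h | h
    · rwa [h]
    · exact hpos _ ⟨h, abs_lt.2 ⟨by linarith [ht.1], by linarith [ht.2]⟩⟩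

theorem IsCircularSolution.exists_nonpos_of_periodic (hx : IsCircularSolution x)
    (h₁ : deriv x 0 = 0) (hT₀ : 0 < T) (hT : Periodic x T) : ∃ t ∈ Ioo 0 T, x t ≤ 0 := by
  by_contra! hpos
  have hdecr : 0 < -deriv x T := pos_of_hasDerivAt_pos (f := fun t => -deriv x t)
    (fun t => (hx.2 t).neg.congr_deriv (neg_neg _)) (by simp [h₁]) hT₀
    fun t ht => attraction_pos one_half_pos (hpos t ht)
  have hxT : deriv x T = deriv x 0 := by
    simpa [deriv_comp_add_const] using congrArg (deriv · 0) (funext hT)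
  linarith

theorem IsCircularSolution.isArch_comp_sub_of_isMinimalPeriod (hx : IsCircularSolution x)
    (h₀ : 0 < x 0) (h₁ : deriv x 0 = 0) (hT : IsMinimalPeriod x T) :
    IsArch (fun t => x (t - T / 4)) (T / 2) := by
  obtain ⟨r, hr, hxr⟩ := hx.exists_nonpos_of_periodic h₁ hT.1.1 hT.1.2
  obtain ⟨c, hc, hxc, hpos⟩ := exists_first_zero hx.continuous
    (nhdsWithin_le_nhds (hx.continuous.continuousAt.eventually_const_lt h₀)) hr.1 hxr
  have harch := hx.isArch_of_even h₀ h₁ hc.1 hxc hpos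
  have hTc : T = 2 * (2 * c) := (hT.comp_add_const (-c)).unique harch.isMinimalPeriod
  convert harch using 3 <;> linarith

theorem IsCircularSolution.pos_of_nonneg (hx : IsCircularSolution x) (h₀ : 0 < x 0)
    (hnonneg : ∀ t ∈ Icc 0 s, 0 ≤ x t) : ∀ t ∈ Ico 0 s, 0 < x t := fun t ht => by
  refine (hnonneg t ⟨ht.1, ht.2.le⟩).lt_of_ne' fun hxt => ?_
  have ht₀ : 0 < t := ht.1.lt_of_ne (by rintro rfl; exact h₀.ne' hxt)
  have hmin : IsLocalMin x t := by
    filter_upwards [Icc_mem_nhds ht₀ ht.2] with u hu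
    exact hxt ▸ hnonneg u hu
  simp [hx.eq_zero hxt hmin.deriv_eq_zero] at h₀

theorem IsCircularSolution.sub_two_mul_sq_lt (hx : IsCircularSolution x) (h₁ : deriv x 0 = 0)
    (hs : 0 < s) : x 0 - 2 * s ^ 2 < x s := by
  have hvelocity : ∀ t, 0 < t → 0 < deriv x t + 4 * t := fun t ht =>
    pos_of_hasDerivAt_pos (f := fun t => deriv x t + 4 * t)
      (fun u => (hx.2 u).add ((hasDerivAt_id' u).const_mul 4)) (by simp [h₁]) ht
      fun u _ => by linarith [attraction_half_lt_four (x u)]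
  have := pos_of_hasDerivAt_pos (f := fun t => x t - x 0 + 2 * t ^ 2)
    (fun u => ((hx.hasDerivAt u).sub_const _).add (((hasDerivAt_id' u).fun_pow 2).const_mul 2))
    (by simp) hs fun t ht => (hvelocity t ht.1).trans_eq (by push_cast; ring)
  linarith

/-- Sturm comparison with `y'' + ω² y = 0`. -/
theorem IsCircularSolution.exists_neg {ω : ℝ} (hx : IsCircularSolution x) (h₀ : 0 < x 0)
    (h₁ : deriv x 0 = 0) (hω : 0 < ω) (hωx : ω ^ 2 < invDist (x 0) (1 / 2) ^ 3) :
    ∃ t ∈ Icc 0 (π / 2 / ω), x t < 0 := by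
  by_contra! hnonneg
  have hpos := hx.pos_of_nonneg h₀ hnonneg
  have hs : 0 < π / 2 / ω := by positivity
  have hfreq (t : ℝ) : ω ^ 2 < invDist (x t) (1 / 2) ^ 3 := by
    have henergy := hx.energy t
    have hle : invDist (x 0) (1 / 2) ≤ invDist (x t) (1 / 2) := by
      rw [h₁] at henergy
      linarith [sq_nonneg (deriv x t)]
    exact hωx.trans_le (pow_le_pow_left₀ (invDist_pos one_half_pos).le hle 3)
  have hW (t : ℝ) : HasDerivAt (fun t => -(deriv x t * cos (ω * t) + ω * x t * sin (ω * t)))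
      (x t * cos (ω * t) * (invDist (x t) (1 / 2) ^ 3 - ω ^ 2)) t := by
    have hωt : HasDerivAt (fun t => ω * t) ω t := by simpa using (hasDerivAt_id t).const_mul ω
    refine (((hx.2 t).mul hωt.cos).add
      (((hx.hasDerivAt t).const_mul ω).mul hωt.sin)).neg.congr_deriv ?_
    simp only [attraction]
    ring
  have hend := pos_of_hasDerivAt_pos hW (by simp [h₁]) hs fun t ht => by
    have hcos : 0 < cos (ω * t) := cos_pos_of_mem_Ioo
      ⟨by linarith [mul_pos hω ht.1, pi_pos], by simpa [mul_comm] using (lt_div_iff₀ hω).1 ht.2⟩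
    have hxt := hpos t ⟨ht.1.le, ht.2⟩
    have := sub_pos.2 (hfreq t)
    positivity
  rw [mul_div_cancel₀ _ hω.ne', cos_pi_div_two, sin_pi_div_two] at hend
  have := mul_nonneg hω.le (hnonneg _ (right_mem_Icc.2 hs.le))
  linarith

theorem isCircularSolution_flow (a b : ℝ) : IsCircularSolution (flow 0 a b) :=
  isSolution_force_zero_iff.1 (flow_spec (e := 0) (by simp) a b).1

theorem exists_flow_touching_zero {T : ℝ≥0} {a b : ℝ} (ha : 0 < a)
    (ha_pos : ∀ t ∈ Icc (0 : ℝ) T, 0 < flow 0 a 0 t) (hb : 0 < b)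
    (hb_neg : ∃ t ∈ Icc (0 : ℝ) T, flow 0 b 0 t < 0) :
    ∃ c > 0, (∀ t ∈ Icc (0 : ℝ) T, 0 ≤ flow 0 c 0 t) ∧ ∃ t ∈ Icc (0 : ℝ) T, flow 0 c 0 t = 0 := by
  have hcont : Continuous fun a => path T (flow 0 a 0) :=
    continuous_path_flow_zero.comp (by fun_prop : Continuous fun a : ℝ => (a, (0 : ℝ)))
  have hpath (a : ℝ) (t : Icc (0 : ℝ) T) : path T (flow 0 a 0) t = flow 0 a 0 t :=
    path_apply (isCircularSolution_flow a 0).continuous t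
  have hU : IsOpen {a | ∀ t ∈ Icc (0 : ℝ) T, 0 < flow 0 a 0 t} := by
    convert (ContinuousMap.isOpen_setOfPred_mapsTo isCompact_univ
      (isOpen_Ioi (a := (0 : ℝ)))).preimage hcont using 1
    ext a
    simp only [preimage_ofPred_eq, mem_ofPred_eq, MapsTo, mem_univ, true_imp_iff, hpath, mem_Ioi,
      Subtype.forall]
  have hV : IsOpen {a | ∃ t ∈ Icc (0 : ℝ) T, flow 0 a 0 t < 0} := by
    convert isOpen_iUnion fun t : Icc (0 : ℝ) T =>
      (isOpen_Iio (a := (0 : ℝ))).preimage ((continuous_eval_const t).comp hcont) using 1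
    ext a
    simp only [mem_iUnion, mem_preimage, comp_apply, hpath, mem_Iio, mem_ofPred_eq, Subtype.exists,
      exists_prop]
  by_contra! hcon
  have hcover : Ioi 0 ⊆ {a | ∀ t ∈ Icc (0 : ℝ) T, 0 < flow 0 a 0 t} ∪
      {a | ∃ t ∈ Icc (0 : ℝ) T, flow 0 a 0 t < 0} := fun c hc => by
    refine or_iff_not_imp_right.2 fun h t ht => ?_
    have hnonneg : ∀ t ∈ Icc (0 : ℝ) T, 0 ≤ flow 0 c 0 t := by simpa using h
    exact (hnonneg t ht).lt_of_ne' (hcon c hc hnonneg t ht)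
  obtain ⟨c, -, hc_pos, t, ht, hct⟩ :=
    isPreconnected_Ioi _ _ hU hV hcover ⟨a, ha, ha_pos⟩ ⟨b, hb, hb_neg⟩
  exact (hc_pos t ht).not_gt hct

theorem exists_flow_pos (T : ℝ≥0) : ∃ a > 0, ∀ t ∈ Icc (0 : ℝ) T, 0 < flow 0 a 0 t := by
  have ha : (0 : ℝ) < 2 * T ^ 2 + 1 := by positivity
  obtain ⟨h₀, h₁⟩ := (flow_spec (e := 0) (by simp) (2 * (T : ℝ) ^ 2 + 1) 0).2
  refine ⟨_, ha, fun t ht => ?_⟩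
  rcases ht.1.eq_or_lt with rfl | ht₀
  · exact ha.trans_eq h₀.symm
  · have hlt := (isCircularSolution_flow _ _).sub_two_mul_sq_lt h₁ ht₀
    rw [h₀] at hlt
    linarith [pow_le_pow_left₀ ht.1 ht.2 2]

theorem exists_flow_neg {ω : ℝ} (hω : 0 < ω) (hω₈ : ω ^ 2 < 8) :
    ∃ b > 0, ∃ t ∈ Icc 0 (π / 2 / ω), flow 0 b 0 t < 0 := by
  have hcont : Continuous fun b => invDist b (1 / 2) ^ 3 :=
    (continuous_invDist one_half_pos).pow 3
  have hzero : invDist 0 (1 / 2) = 2 := by simp [invDist]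
  have hlt : ω ^ 2 < invDist 0 (1 / 2) ^ 3 := by rw [hzero]; linarith
  obtain ⟨b, hωb, hb⟩ := ((hcont.continuousAt.eventually (lt_mem_nhds hlt)).filter_mono
    (nhdsWithin_le_nhds (s := Ioi 0)) |>.and eventually_mem_nhdsWithin).exists
  obtain ⟨h₀, h₁⟩ := (flow_spec (e := 0) (by simp) b 0).2
  exact ⟨b, hb, (isCircularSolution_flow b 0).exists_neg (h₀.symm ▸ hb) h₁ hω (h₀.symm ▸ hωb)⟩

theorem exists_isArch (hs : π / √8 < s) : ∃ x, IsArch x s := by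
  have hs₀ : 0 < s := lt_trans (by positivity) hs
  obtain ⟨T, hT⟩ : ∃ T : ℝ≥0, (T : ℝ) = s / 2 := ⟨⟨s / 2, by positivity⟩, rfl⟩
  have hω : π / 2 / (π / s) = T := by rw [hT]; field_simp
  have hω₈ : (π / s) ^ 2 < 8 :=
    (lt_sqrt (by positivity)).1 ((div_lt_comm₀ (by positivity) hs₀).1 hs)
  obtain ⟨a, ha, ha_pos⟩ := exists_flow_pos T
  obtain ⟨b, hb, hb_neg⟩ := exists_flow_neg (by positivity) hω₈
  rw [hω] at hb_neg
  obtain ⟨c, hc, hnonneg, t, ht, hct⟩ := exists_flow_touching_zero ha ha_pos hb hb_neg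
  obtain ⟨h₀, h₁⟩ := (flow_spec (e := 0) (by simp) c 0).2
  have hx := isCircularSolution_flow c 0
  have hpos := hx.pos_of_nonneg (h₀.symm ▸ hc) hnonneg
  obtain rfl : t = T := ht.2.antisymm <| not_lt.1 fun h => (hpos t ⟨ht.1, h⟩).ne' hct
  have harch := hx.isArch_of_even (h₀.symm ▸ hc) h₁ (by rw [hT]; positivity) hct
    fun t ht => hpos t ⟨ht.1.le, ht.2⟩
  exact ⟨_, by simpa [hT, mul_div_cancel₀] using harch⟩
end Circular

section ParabolicFrame

variable {x y : ℝ → ℝ} {s d : ℝ}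

/-- `x` is a solution of the circular problem of antiperiod `s`, and `y` a solution of the
linearized equation of Wronskian `1` with `x'`, such that the monodromy over the time `s` is the
non-diagonalizable map `x' ↦ -x'`, `y ↦ -y + d x'`. -/
structure IsParabolicFrame (x y : ℝ → ℝ) (s d : ℝ) : Prop where
  circular : IsCircularSolution x
  hill : IsSolution (fun y t => attractionX (x t) (1 / 2) * y) y
  wronskian : deriv x 0 * deriv y 0 - deriv (deriv x) 0 * y 0 = 1
  antiperiodic : Antiperiodic x s
  shift : ∀ t, y (t + s) = -y t + d * deriv x t
  ne_zero : d ≠ 0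

theorem antiperiodic_deriv (hx : Antiperiodic x s) : Antiperiodic (deriv x) s := fun t => by
  rw [← deriv_comp_add_const, funext hx, deriv.fun_neg]

theorem IsArch.hill_pos_right (h : IsArch x s)
    (hy : IsSolution (fun y t => attractionX (x t) (1 / 2) * y) y) (hy₀ : y 0 = 0)
    (hy₁ : 0 < deriv y 0) : 0 < y s := by
  by_contra! hys
  obtain ⟨c, hc, hyc, hpos⟩ := exists_first_zero hy.continuous
    (eventually_pos_right_of_deriv_pos hy₀ hy₁) h.length_pos hys
  have hW (t : ℝ) : HasDerivAt (fun t => x t * deriv y t - deriv x t * y t)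
      (x t * y t * (3 * x t ^ 2 * invDist (x t) (1 / 2) ^ 5)) t :=
    (((h.circular.hasDerivAt t).mul (hy.2 t)).sub
      ((h.circular.2 t).mul (hy.hasDerivAt t))).congr_deriv (by
        simp only [attraction, attractionX]; ring)
  have hWc := pos_of_hasDerivAt_pos hW (by simp [h.zero, hy₀]) hc.1 fun t ht => by
    have hxt := h.pos t ⟨ht.1, ht.2.trans_le hc.2⟩
    have hyt := hpos t ht
    have := invDist_pos (x := x t) one_half_pos
    positivity
  have hyc' := deriv_nonpos_of_eventually_pos_left hyc
    (Filter.mem_of_superset (Ioo_mem_nhdsLT hc.1) hpos)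
  have hxc : 0 ≤ x c := by
    rcases hc.2.lt_or_eq with hcs | rfl
    · exact (h.pos c ⟨hc.1, hcs⟩).le
    · exact h.right_zero.ge
  rw [hyc, mul_zero, sub_zero] at hWc
  exact hWc.not_ge (mul_nonpos_of_nonneg_of_nonpos hxc hyc')

theorem IsArch.exists_isParabolicFrame (h : IsArch x s) :
    ∃ y d, IsParabolicFrame x y s d := by
  obtain ⟨hχ, hχ'⟩ := h.circular.isSolution_deriv
  have hq := h.circular.continuous_attractionX
  have hv := h.velocity_pos
  obtain ⟨y, hy, hy₀, hy₁⟩ := (lipschitzForce_linear hq).exists_isSolution 0 (deriv x 0)⁻¹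
  have hχ₀ : deriv (deriv x) 0 = 0 := by simp [hχ', h.zero, attraction]
  have hχs : deriv (deriv x) s = 0 := by simp [hχ', h.right_zero, attraction]
  have hW : deriv x 0 * deriv y 0 - deriv (deriv x) 0 * y 0 = 1 := by
    rw [hy₀, hy₁, mul_zero, sub_zero, mul_inv_cancel₀ hv.ne']
  have hys : 0 < y s := h.hill_pos_right hy hy₀ (by rw [hy₁]; positivity)
  have hys' : deriv y s = -(deriv x 0)⁻¹ := by
    have hWs := hχ.wronskian_eq hy s 0
    rw [hW, hχs, zero_mul, sub_zero, h.deriv_right, neg_mul] at hWs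
    rw [← neg_eq_iff_eq_neg]
    exact eq_inv_of_mul_eq_one_right (by linarith)
  have hshift : IsSolution (fun y t => attractionX (x t) (1 / 2) * y) fun t => y (t + s) := by
    simpa only [h.antiperiodic _, attractionX_neg] using hy.comp_add_const s
  have heq := hshift.eq_linear_combination hq hy hχ (a := -1) (b := y s / deriv x 0) (t₀ := 0)
    (by simp [hy₀, hv.ne']) (by simp [deriv_comp_add_const, hys', hy₁, hχ₀])
  exact ⟨y, y s / deriv x 0, h.circular, hy, hW, h.antiperiodic,
    fun t => by simpa using congrFun heq.1 t, (div_pos hys hv).ne'⟩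

namespace IsParabolicFrame

variable {α β v : ℝ}

theorem translate (h : IsParabolicFrame x y s d) (c : ℝ) :
    IsParabolicFrame (fun t => x (t + c)) (fun t => y (t + c)) s d where
  circular := h.circular.comp_add_const c
  hill := h.hill.comp_add_const c
  wronskian := by
    have hχ : deriv (fun t => x (t + c)) = fun t => deriv x (t + c) :=
      funext fun t => deriv_comp_add_const ..
    simp only [hχ, deriv_comp_add_const, zero_add, ← h.wronskian]
    exact h.circular.isSolution_deriv.1.wronskian_eq h.hill c 0
  antiperiodic t := by simp only [add_right_comm t s c, h.antiperiodic (t + c)]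
  shift t := by simp only [add_right_comm t s c, h.shift, deriv_comp_add_const]
  ne_zero := h.ne_zero

theorem shift_nat (h : IsParabolicFrame x y s d) (k : ℕ) (t : ℝ) :
    y (t + k * s) = (-1) ^ k * (y t - k * d * deriv x t) := by
  induction k with
  | zero => simp
  | succ k ih =>
    rw [Nat.cast_succ, add_one_mul, ← add_assoc, h.shift, ih,
      (antiperiodic_deriv h.antiperiodic).add_nat_mul_eq]
    ring

theorem deriv_shift_nat (h : IsParabolicFrame x y s d) (k : ℕ) (t : ℝ) :
    deriv y (t + k * s) = (-1) ^ k * (deriv y t - k * d * deriv (deriv x) t) := by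
  rw [← deriv_comp_add_const, funext (h.shift_nat k)]
  exact (((h.hill.hasDerivAt t).sub
    ((h.circular.isSolution_deriv.1.hasDerivAt t).const_mul _)).const_mul _).deriv

end IsParabolicFrame

end ParabolicFrame

section Branches

variable {x y : ℝ → ℝ} {s d e α β v : ℝ} {m p : ℕ}

theorem IsSolution.force_comp_const_sub (he : |e| < 1) (hx : IsSolution (force · · e) x) (m : ℕ) :
    IsSolution (force · · e) fun t => x (2 * m * π - t) := by
  have hforce (z t : ℝ) : force z (2 * m * π - t) e = force z t e := by
    have hradius := ((radius_periodic he).nat_mul m) (-t)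
    rw [radius_neg he] at hradius
    rw [force, force, show 2 * m * π - t = -t + m * (2 * π) by ring, hradius]
  have h := (hx.comp_add_const (2 * m * π)).comp_neg
  simpa only [neg_add_eq_sub, hforce] using h

/-- `(α, β)` is the direction of the initial data of the odd solutions, `(0, 1)`, or of the even
solutions, `(1, 0)`. -/
def IsParityDirection (α β : ℝ) : Prop :=
  (α = 0 ∧ β = 1) ∨ (α = 1 ∧ β = 0)

theorem IsParityDirection.eq_of_isSolution_force (hαβ : IsParityDirection α β) (he : |e| < 1)
    (hx : IsSolution (force · · e) x) (h₀ : x 0 = v * α) (h₁ : deriv x 0 = v * β)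
    (hhalf : β * x (m * π) + α * deriv x (m * π) = 0) :
    x (2 * m * π) = x 0 ∧ deriv x (2 * m * π) = deriv x 0 := by
  have hz := hx.force_comp_const_sub he m
  have hmid : 2 * m * π - m * π = m * π := by ring
  rcases hαβ with ⟨rfl, rfl⟩ | ⟨rfl, rfl⟩
  · have hodd : x = fun t => -x (2 * m * π - t) :=
      (lipschitzForce_force he).eq_of_isSolution hx
        (by simpa only [force_neg, neg_neg] using hz.neg)
        (t₀ := m * π) (by simp_all) (by simp [deriv_comp_const_sub, hmid])
    have hodd₀ : x 0 = -x (2 * m * π) := by simpa only [sub_zero] using congrFun hodd 0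
    have hodd₁ : deriv x 0 = deriv x (2 * m * π) := by
      simpa [deriv_comp_const_sub] using congrArg (deriv · 0) hodd
    exact ⟨by linarith, hodd₁.symm⟩
  · have heven : x = fun t => x (2 * m * π - t) :=
      (lipschitzForce_force he).eq_of_isSolution hx hz
        (t₀ := m * π) (by simp [hmid]) (by simp_all [deriv_comp_const_sub])
    have heven₀ : x 0 = x (2 * m * π) := by simpa only [sub_zero] using congrFun heven 0
    have heven₁ : deriv x 0 = -deriv x (2 * m * π) := by
      simpa only [deriv_comp_const_sub, sub_zero] using congrArg (deriv · 0) heven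
    exact ⟨heven₀.symm, by linarith⟩

namespace IsParabolicFrame

theorem transversal (h : IsParabolicFrame x y s d) (hαβ : IsParityDirection α β)
    (h₀ : x 0 = v * α) (h₁ : deriv x 0 = v * β) :
    (β * deriv x 0 - α * deriv (deriv x) 0) * (β * deriv x 0 + α * deriv (deriv x) 0) ≠ 0 := by
  have hW := h.wronskian
  rcases hαβ with ⟨rfl, rfl⟩ | ⟨rfl, rfl⟩
  · have hx'' : deriv (deriv x) 0 = 0 := by simp [h.circular.isSolution_deriv.2, h₀, attraction]
    have hx' : deriv x 0 ≠ 0 := fun hx' => by simp [hx', hx''] at hW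
    simpa using hx'
  · have hx' : deriv x 0 = 0 := by simpa using h₁
    have hx'' : deriv (deriv x) 0 ≠ 0 := fun hx'' => by simp [hx', hx''] at hW
    simpa [hx'] using hx''

theorem exists_hill (h : IsParabolicFrame x y s d) (hαβ : IsParityDirection α β)
    (h₀ : x 0 = v * α) (h₁ : deriv x 0 = v * β) (hp : p ≠ 0) :
    ∃ w, IsSolution (fun y t => attractionX (x t) (1 / 2) * y) w ∧ w 0 = α ∧ deriv w 0 = β ∧
      β * w (p * s) + α * deriv w (p * s) ≠ 0 := by
  have hW := h.wronskian
  have htrans := h.transversal hαβ h₀ h₁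
  have hmul : α * β = 0 := by rcases hαβ with ⟨rfl, -⟩ | ⟨-, rfl⟩ <;> simp
  let A := α * deriv y 0 - β * y 0
  let B := β * deriv x 0 - α * deriv (deriv x) 0
  obtain ⟨hw, hw'⟩ := h.circular.isSolution_deriv.1.linear_combination h.hill A B
  refine ⟨_, hw, ?_, ?_, ?_⟩
  · linear_combination α * hW
  · rw [hw']
    linear_combination β * hW
  · have hanti := antiperiodic_deriv h.antiperiodic
    have hx' := hanti.add_nat_mul_eq p (x := 0)
    have hx'' := (antiperiodic_deriv hanti).add_nat_mul_eq p (x := 0)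
    have hy := h.shift_nat p 0
    have hy' := h.deriv_shift_nat p 0
    rw [zero_add] at hx' hx'' hy hy'
    have hend : β * (A * deriv x (p * s) + B * y (p * s)) +
        α * (A * deriv (deriv x) (p * s) + B * deriv y (p * s)) =
        (-1) ^ (p + 1) * (p * d) * (B * (β * deriv x 0 + α * deriv (deriv x) 0)) := by
      rw [hx', hx'', hy, hy']
      linear_combination (-1) ^ p * 2 * α * β * hW + 2 * (-1) ^ p * hmul
    rw [hw', hend]
    have := h.ne_zero
    positivity

variable {V : ℝ → ℝ} {V' : ℝ}

theorem exists_branch (h : IsParabolicFrame x y s d) (hαβ : IsParityDirection α β)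
    (h₀ : x 0 = v * α) (h₁ : deriv x 0 = v * β) (hp : p ≠ 0) (hs : m * π = p * s) :
    ∃ (V : ℝ → ℝ) (V' : ℝ), HasStrictDerivAt V V' 0 ∧ V 0 = v ∧
      (∀ᶠ e in 𝓝 0, bifurcation (m * π) α β (e, V e) = 0) ∧
      ∀ᶠ z in 𝓝 (0, v), bifurcation (m * π) α β z = 0 → V z.1 = z.2 := by
  have hflow : flow 0 (v * α) (v * β) = x :=
    h₀ ▸ h₁ ▸ flow_eq (by simp) (isSolution_force_zero_iff.2 h.circular)
  obtain ⟨w, hw, hw₀, hw₁, hne⟩ := h.exists_hill hαβ h₀ h₁ hp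
  have hT : ((m * NNReal.pi : ℝ≥0) : ℝ) = m * π := by simp
  rw [← hs] at hne
  rw [← hT] at hne ⊢
  refine Sitnikov.exists_branch ?_ (by simpa only [hflow] using hw) hw₀ hw₁ hne
  have hx := h.antiperiodic.add_nat_mul_eq p (x := 0)
  have hx' := (antiperiodic_deriv h.antiperiodic).add_nat_mul_eq p (x := 0)
  rw [zero_add] at hx hx'
  rw [bifurcation, hflow, hT, hs, hx, hx', h₀, h₁]
  rcases hαβ with ⟨rfl, rfl⟩ | ⟨rfl, rfl⟩ <;> ring

theorem hasDerivAt_linearizedTrace_branch (h : IsParabolicFrame x y s d)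
    (hαβ : IsParityDirection α β) (hs : m * π = p * s)
    (hV : HasStrictDerivAt V V' 0) (h₀ : x 0 = V 0 * α) (h₁ : deriv x 0 = V 0 * β)
    (hV_zero : ∀ᶠ e in 𝓝 0, bifurcation (m * π) α β (e, V e) = 0) :
    HasDerivAt (linearizedTrace m fun t e => flow e (V e * α) (V e * β) t)
      (2 * p * d * ∫ t in (0)..2 * p * s, tidal (x t) * deriv x t * sin t) 0 := by
  have hflow : flow 0 (V 0 * α) (V 0 * β) = x :=
    h₀ ▸ h₁ ▸ flow_eq (by simp) (isSolution_force_zero_iff.2 h.circular)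
  have hT : 2 * m * π = 2 * p * s := by rw [mul_assoc, hs, mul_assoc]
  have hspec := eventually_abs_lt_one.mono fun e he => flow_spec he (V e * α) (V e * β)
  have htrace := hasDerivAt_linearizedTrace (m := m) (c := -(2 * p * d))
    (x := fun e => flow e (V e * α) (V e * β)) (y := y) (hspec.mono fun e he => he.1)
    ((hV.mul_const α).congr_of_eventuallyEq (hspec.mono fun e he => he.2.1.symm))
    ((hV.mul_const β).congr_of_eventuallyEq (hspec.mono fun e he => he.2.2.symm))
    (by
      filter_upwards [hV_zero, hspec, eventually_abs_lt_one] with e hzero ⟨hsol, ha, hb⟩ he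
      exact hαβ.eq_of_isSolution_force he hsol ha hb hzero)
  have hend := h.shift_nat (2 * p) 0
  have hend' := h.deriv_shift_nat (2 * p) 0
  simp only [zero_add, Nat.cast_mul, Nat.cast_ofNat, (even_two_mul p).neg_one_pow, one_mul]
    at hend hend'
  simp only [hflow, hT, neg_neg] at htrace
  exact htrace h.hill h.wronskian (by rw [hend]; ring) (by rw [hend']; ring)

end IsParabolicFrame

end Branches

section Families

variable {x y : ℝ → ℝ} {φ : ℝ → ℝ → ℝ} {ν : ℝ → ℝ} {s d e₀ α β : ℝ} {m p : ℕ}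

/-- The common form of the odd families, `(α, β) = (0, 1)`, and of the even families,
`(α, β) = (1, 0)`: the solution `φ(·,e)` has the initial data `ν e • (α, β)`. -/
structure IsFamily (m : ℕ) (α β e₀ : ℝ) (ν : ℝ → ℝ) (φ : ℝ → ℝ → ℝ) : Prop where
  pos : 0 < e₀
  le_one : e₀ ≤ 1
  solution : ∀ e ∈ Ico 0 e₀, IsSolution (force · · e) (φ · e)
  initial : ∀ e ∈ Ico 0 e₀, φ 0 e = ν e * α ∧ deriv (φ · e) 0 = ν e * β
  half_period : ∀ e ∈ Ico 0 e₀, β * φ (m * π) e + α * deriv (φ · e) (m * π) = 0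
  continuousOn : ContinuousOn ν (Ico 0 e₀)

theorem IsOddFamily.isFamily (h : IsOddFamily m p e₀ φ) :
    IsFamily m 0 1 e₀ (fun e => deriv (φ · e) 0) φ where
  pos := h.pos
  le_one := h.le_one
  solution := h.solution
  initial e he := by simpa using h.initial e he
  half_period e he := by simpa using h.half_period e he
  continuousOn := h.continuousOn_velocity

theorem IsEvenFamily.isFamily (h : IsEvenFamily m p e₀ φ) :
    IsFamily m 1 0 e₀ (φ 0) φ where
  pos := h.pos
  le_one := h.le_one
  solution := h.solution
  initial e he := by simpa using h.initial e he
  half_period e he := by simpa using h.half_period e he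
  continuousOn := h.continuousOn_position

namespace IsFamily

theorem zero_mem (h : IsFamily m α β e₀ ν φ) : (0 : ℝ) ∈ Ico 0 e₀ :=
  ⟨le_rfl, h.pos⟩

theorem flow_eq (h : IsFamily m α β e₀ ν φ) {e : ℝ} (he : e ∈ Ico 0 e₀) :
    flow e (ν e * α) (ν e * β) = (φ · e) := by
  rw [← (h.initial e he).1, ← (h.initial e he).2]
  exact Sitnikov.flow_eq (abs_lt.2 ⟨by linarith [he.1], he.2.trans_le h.le_one⟩) (h.solution e he)

theorem isOddFamily (h : IsFamily m 0 1 e₀ ν φ) (hx : (φ · 0) = x) (hv : 0 < deriv x 0)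
    (hper : IsMinimalPeriod x (2 * m * π / p)) : IsOddFamily m p e₀ φ where
  pos := h.pos
  le_one := h.le_one
  solution := h.solution
  initial e he := by simpa using (h.initial e he).1
  half_period e he := by simpa using h.half_period e he
  continuousOn_velocity := h.continuousOn.congr fun e he => by simpa using (h.initial e he).2
  velocity_pos := hx ▸ hv
  minimal_period := hx ▸ hper

theorem isEvenFamily (h : IsFamily m 1 0 e₀ ν φ) (hx : (φ · 0) = x) (hv : 0 < x 0)
    (hper : IsMinimalPeriod x (2 * m * π / p)) : IsEvenFamily m p e₀ φ where
  pos := h.pos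
  le_one := h.le_one
  solution := h.solution
  initial e he := by simpa using (h.initial e he).2
  half_period e he := by simpa using h.half_period e he
  continuousOn_position := h.continuousOn.congr fun e he => by simpa using (h.initial e he).1
  position_pos := by rwa [← hx] at hv
  minimal_period := hx ▸ hper

theorem hasDerivWithinAt_linearizedTrace (h : IsFamily m α β e₀ ν φ)
    (hαβ : IsParityDirection α β) (hframe : IsParabolicFrame (φ · 0) y s d) (hp : p ≠ 0)
    (hs : m * π = p * s) :
    HasDerivWithinAt (linearizedTrace m φ)
      (2 * p * d * ∫ t in (0)..2 * p * s, tidal (φ t 0) * deriv (φ · 0) t * sin t) (Ici 0) 0 := by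
  obtain ⟨h₀, h₁⟩ := h.initial 0 h.zero_mem
  obtain ⟨V, V', hV, hV₀, hV_zero, hV_unique⟩ := hframe.exists_branch hαβ h₀ h₁ hp hs
  rw [← hV₀] at h₀ h₁
  have htrace := hframe.hasDerivAt_linearizedTrace_branch hαβ hs hV h₀ h₁ hV_zero
  have hν : ContinuousWithinAt (fun e => (e, ν e)) (Ico 0 e₀) 0 :=
    continuousWithinAt_id.prodMk (h.continuousOn 0 h.zero_mem)
  have heq : ∀ e ∈ Ico 0 e₀, V e = ν e →
      linearizedTrace m φ e = linearizedTrace m (fun t e => flow e (V e * α) (V e * β) t) e :=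
    fun e he hVe => by
      simp only [linearizedTrace, hVe, h.flow_eq he]
  refine htrace.hasDerivWithinAt.congr_of_eventuallyEq_of_mem ?_ self_mem_Ici
  rw [← nhdsWithin_Ico_eq_nhdsGE h.pos]
  filter_upwards [self_mem_nhdsWithin, hν.tendsto.eventually hV_unique] with e he hVe
  refine heq e he (hVe ?_)
  simpa [bifurcation, h.flow_eq he] using h.half_period e he

end IsFamily

theorem IsParabolicFrame.exists_isFamily (h : IsParabolicFrame x y s d)
    (hαβ : IsParityDirection α β) {v : ℝ} (h₀ : x 0 = v * α) (h₁ : deriv x 0 = v * β) (hp : p ≠ 0)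
    (hs : m * π = p * s) :
    ∃ e₀ ν φ, IsFamily m α β e₀ ν φ ∧ (φ · 0) = x := by
  obtain ⟨V, V', hV, hV₀, hV_zero, -⟩ := h.exists_branch hαβ h₀ h₁ hp hs
  have hV_cont : ∀ᶠ e in 𝓝 0, ContinuousAt V e := by
    obtain ⟨_, S, hS, hlip⟩ := hV.hasStrictFDerivAt.exists_lipschitzOnWith
    filter_upwards [eventually_mem_nhds_iff.2 hS] with e he
    exact hlip.continuousOn.continuousAt he
  obtain ⟨ε, hε, hball⟩ := Metric.eventually_nhds_iff.1
    (eventually_abs_lt_one.and (hV_zero.and hV_cont))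
  have hball' {e : ℝ} (he : e ∈ Ico 0 (min ε 1)) := hball (y := e)
    (by simpa [abs_of_nonneg he.1] using he.2.trans_le (min_le_left _ _))
  refine ⟨min ε 1, V, fun t e => flow e (V e * α) (V e * β) t, ⟨lt_min hε one_pos,
    min_le_right _ _, fun e he => ?_, fun e he => ?_, fun e he => ?_, fun e he => ?_⟩, ?_⟩
  · exact (flow_spec (hball' he).1 _ _).1
  · exact (flow_spec (hball' he).1 _ _).2
  · exact (hball' he).2.1
  · exact (hball' he).2.2.continuousWithinAt
  · beta_reduce
    rw [hV₀, ← h₀, ← h₁]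
    exact flow_eq (by simp) (isSolution_force_zero_iff.2 h.circular)

theorem two_mul_mul_pi_div_eq (hp : p ≠ 0) (hs : m * π = p * s) : 2 * m * π / p = 2 * s := by
  rw [mul_assoc, hs]
  field_simp

namespace IsArch

theorem deriv_half (h : IsArch x s) : deriv x (s / 2) = 0 := by
  have hanti := antiperiodic_deriv h.antiperiodic (-(s / 2))
  have hodd := deriv_comp_neg x (s / 2)
  rw [funext (h.circular.odd h.zero), deriv.fun_neg] at hodd
  rw [show -(s / 2) + s = s / 2 by ring] at hanti
  linarith

theorem exists_isOddFamily (h : IsArch x s) (hframe : IsParabolicFrame x y s d) (hp : p ≠ 0)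
    (hs : m * π = p * s) : ∃ e₀ φ, IsOddFamily m p e₀ φ := by
  obtain ⟨e₀, ν, φ, hφ, hφ₀⟩ := hframe.exists_isFamily (v := deriv x 0) (.inl ⟨rfl, rfl⟩)
    (by simp [h.zero]) (by simp) hp hs
  exact ⟨e₀, φ, hφ.isOddFamily hφ₀ h.velocity_pos (two_mul_mul_pi_div_eq hp hs ▸ h.isMinimalPeriod)⟩

theorem exists_isEvenFamily (h : IsArch x s) (hframe : IsParabolicFrame x y s d) (hp : p ≠ 0)
    (hs : m * π = p * s) : ∃ e₀ φ, IsEvenFamily m p e₀ φ := by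
  have hpos := h.length_pos
  obtain ⟨e₀, ν, φ, hφ, hφ₀⟩ := (hframe.translate (s / 2)).exists_isFamily (v := x (s / 2))
    (.inr ⟨rfl, rfl⟩) (by simp) (by simp [deriv_comp_add_const, h.deriv_half]) hp hs
  exact ⟨e₀, φ, hφ.isEvenFamily hφ₀ (h.pos _ ⟨by linarith, by linarith⟩)
    (two_mul_mul_pi_div_eq hp hs ▸ h.isMinimalPeriod.comp_add_const (s / 2))⟩

end IsArch

theorem IsOddFamily.eq_of_isArch (h : IsOddFamily m p e₀ φ) (hx : IsArch x s) (hp : p ≠ 0)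
    (hs : m * π = p * s) : (φ · 0) = x := by
  have hmem := h.isFamily.zero_mem
  have harch := (isSolution_force_zero_iff.1 (h.solution 0 hmem)).isArch_of_isMinimalPeriod
    (h.initial 0 hmem) h.velocity_pos h.minimal_period
  rw [two_mul_mul_pi_div_eq hp hs, mul_div_cancel_left₀ _ two_ne_zero] at harch
  exact harch.eq hx

theorem IsEvenFamily.eq_of_isArch (h : IsEvenFamily m p e₀ φ) (hx : IsArch x s) (hp : p ≠ 0)
    (hs : m * π = p * s) : (φ · 0) = fun t => x (t + s / 2) := by
  have hmem := h.isFamily.zero_mem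
  have harch := (isSolution_force_zero_iff.1
    (h.solution 0 hmem)).isArch_comp_sub_of_isMinimalPeriod h.position_pos (h.initial 0 hmem)
      h.minimal_period
  rw [two_mul_mul_pi_div_eq hp hs, mul_div_cancel_left₀ _ two_ne_zero,
    show 2 * s / 4 = s / 2 by ring]
    at harch
  ext t
  simpa using congrFun (harch.eq hx) (t + s / 2)

theorem IsOddFamily.hasDerivWithinAt_linearizedTrace (h : IsOddFamily m p e₀ φ) (hx : IsArch x s)
    (hframe : IsParabolicFrame x y s d) (hp : p ≠ 0) (hs : m * π = p * s) :
    HasDerivWithinAt (linearizedTrace m φ)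
      (2 * p * d * ∫ t in (0)..2 * p * s, tidal (x t) * deriv x t * sin t) (Ici 0) 0 := by
  obtain rfl := h.eq_of_isArch hx hp hs
  exact h.isFamily.hasDerivWithinAt_linearizedTrace (.inl ⟨rfl, rfl⟩) hframe hp hs

theorem IsEvenFamily.hasDerivWithinAt_linearizedTrace (h : IsEvenFamily m p e₀ φ)
    (hx : IsArch x s) (hframe : IsParabolicFrame x y s d) (hp : p ≠ 0) (hs : m * π = p * s) :
    HasDerivWithinAt (linearizedTrace m φ)
      (2 * p * d * ∫ t in (0)..2 * p * s,
        tidal (x (t + s / 2)) * deriv x (t + s / 2) * sin t) (Ici 0) 0 := by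
  have hφ₀ := h.eq_of_isArch hx hp hs
  have htrace := h.isFamily.hasDerivWithinAt_linearizedTrace (.inr ⟨rfl, rfl⟩)
    (hφ₀ ▸ hframe.translate (s / 2)) hp hs
  simpa only [congrFun hφ₀, hφ₀, deriv_comp_add_const] using htrace

theorem IsArch.integral_shift {n : ℕ} (h : IsArch x s) (hs : s / 2 = n * π) (p : ℕ) :
    ∫ t in (0)..2 * p * s, tidal (x (t + s / 2)) * deriv x (t + s / 2) * sin t =
      (-1) ^ n * ∫ t in (0)..2 * p * s, tidal (x t) * deriv x t * sin t := by
  set f : ℝ → ℝ := fun t => tidal (x t) * deriv x t * sin t with hf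
  have hf_per : Periodic f (2 * p * s) := by
    have hx := h.antiperiodic.periodic_two_mul
    have hx' := (antiperiodic_deriv h.antiperiodic).periodic_two_mul
    have hsin : Periodic sin (2 * s) := by
      have hs' : ((2 * n : ℕ) : ℝ) * (2 * π) = 2 * s := by push_cast; linarith
      exact hs' ▸ sin_periodic.nat_mul (2 * n)
    have hf_two : Periodic f (2 * s) := fun t => by simp only [hf, hx t, hx' t, hsin t]
    simpa only [mul_assoc, mul_left_comm (p : ℝ)] using hf_two.nat_mul p
  have hsin_half (t : ℝ) : sin t = (-1) ^ n * sin (t + s / 2) := by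
    rw [hs, sin_add_nat_mul_pi, ← mul_assoc, ← mul_pow]
    simp
  have hshift (t : ℝ) : tidal (x (t + s / 2)) * deriv x (t + s / 2) * sin t =
      (-1) ^ n * f (t + s / 2) := by
    rw [hsin_half, mul_left_comm]
  simp only [hshift, intervalIntegral.integral_const_mul]
  rw [intervalIntegral.integral_comp_add_right, zero_add, add_comm _ (s / 2),
    hf_per.intervalIntegral_add_eq (s / 2) 0, zero_add]

end Families

end Sitnikov

end

theorem lemma4p4 (p n : ℕ) (hp : 1 ≤ p) (hn : 1 ≤ n) :
    (∃ (e₀ : ℝ) (φ : ℝ → ℝ → ℝ), Sitnikov.IsOddFamily (2 * p * n) p e₀ φ) ∧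
    (∃ (e₀ : ℝ) (φ : ℝ → ℝ → ℝ), Sitnikov.IsEvenFamily (2 * p * n) p e₀ φ) ∧
    ∃ τodd τeven : ℝ,
      (∀ (e₀ : ℝ) (φ : ℝ → ℝ → ℝ), Sitnikov.IsOddFamily (2 * p * n) p e₀ φ →
        HasDerivWithinAt (Sitnikov.linearizedTrace (2 * p * n) φ) τodd (Set.Ici 0) 0) ∧
      (∀ (e₀ : ℝ) (φ : ℝ → ℝ → ℝ), Sitnikov.IsEvenFamily (2 * p * n) p e₀ φ →
        HasDerivWithinAt (Sitnikov.linearizedTrace (2 * p * n) φ) τeven (Set.Ici 0) 0) ∧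
      τeven = (-1) ^ n * τodd := by
  have hp₀ : p ≠ 0 := Nat.one_le_iff_ne_zero.1 hp
  have hs : ((2 * p * n : ℕ) : ℝ) * π = p * (2 * n * π) := by push_cast; ring
  have hlength : π / √8 < 2 * n * π := calc
    π / √8 < π := div_lt_self pi_pos (Real.lt_sqrt_of_sq_lt (by norm_num))
    _ ≤ 2 * n * π := le_mul_of_one_le_left pi_pos.le (by norm_cast; lia)
  obtain ⟨x, hx⟩ := Sitnikov.exists_isArch hlength
  obtain ⟨y, d, hframe⟩ := hx.exists_isParabolicFrame
  refine ⟨hx.exists_isOddFamily hframe hp₀ hs, hx.exists_isEvenFamily hframe hp₀ hs, _, _,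
    fun e₀ φ hφ => hφ.hasDerivWithinAt_linearizedTrace hx hframe hp₀ hs,
    fun e₀ φ hφ => hφ.hasDerivWithinAt_linearizedTrace hx hframe hp₀ hs, ?_⟩
  rw [hx.integral_shift (by ring) p, mul_left_comm]
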